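/- Let $\Lambda\subset\mathbb{C}$ be a lattice, let $\varphi:\mathbb{C}/\Lambda\to\mathbb{C}P^N$ be a non-constant holomorphic map, and let $h$ be the Hermitian metric on the pulled-back holomorphic tangent bundle $\varphi^*T'\mathbb{C}P^N\to\mathbb{C}/\Lambda$ induced by the Fubini-Study metric (normalized so that a holomorphic curve $g=[g_0:\cdots:g_N]$ has $|dg|^2=\frac{1}{4\pi}\Delta\log\sum_j|g_j|^2$). For a smooth Hermitian metric $k$ on $\varphi^*T'\mathbb{C}P^N$ with canonical (Chern) connection $\nabla$, its curvature acts on smooth sections by $u\mapsto[\nabla_{\partial/\partial z},\nabla_{\partial/\partial\bar z}]u$, where $z$ is the standard coordinate of $\mathbb{C}$. Then there are a smooth function $f:\mathbb{C}/\Lambda\to\mathbb{R}$ and a real number $a>0$ such that $h'=e^{-f}h$ is a Hermitian metric on $\varphi^*T'\mathbb{C}P^N$ whose curvature $R'$ satisfies, for every smooth section $u$ of $\varphi^*T'\mathbb{C}P^N$ and at every point of $\mathbb{C}/\Lambda$, $$h'(R'u,u)\in\mathbb{R},\qquad h'(R'u,u)\ \ge\ a\,h'(u,u)\qquad\text{and}\qquad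 h'(R'u,u)\ \ge\ a\,h(u,u).$$ -/

import Mathlib

open scoped Manifold ContDiff Matrix ComplexConjugate

noncomputable section

/-! ### Complex projective space as a complex manifold -/

/-- Complex projective space of dimension `N`: the lines in `ℂ^{N+1}`. -/
abbrev CP (N : ℕ) : Type := Projectivization ℂ (Fin (N + 1) → ℂ)

/-- The quotient topology of `ℂ^{N+1} ∖ {0}`. -/
instance instTopologicalSpaceCP (N : ℕ) : TopologicalSpace (CP N) :=
  TopologicalSpace.coinduced (Projectivization.mk' ℂ) inferInstance

/-- The point `(ζ₁, …, 1, …, ζ_N)` of `ℂ^{N+1}`, with `1` in position `i`. -/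
def homCoord {N : ℕ} (i : Fin (N + 1)) (ζ : Fin N → ℂ) : Fin (N + 1) → ℂ :=
  Fin.insertNth (α := fun _ => ℂ) i 1 ζ

theorem homCoord_self {N : ℕ} (i : Fin (N + 1)) (ζ : Fin N → ℂ) : homCoord i ζ i = 1 := by
  simp [homCoord]

theorem homCoord_succAbove {N : ℕ} (i : Fin (N + 1)) (ζ : Fin N → ℂ) (j : Fin N) :
    homCoord i ζ (i.succAbove j) = ζ j := by
  simp [homCoord]

theorem homCoord_ne_zero {N : ℕ} (i : Fin (N + 1)) (ζ : Fin N → ℂ) : homCoord i ζ ≠ 0 :=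
  fun h => by simpa [homCoord_self] using congrFun h i

/-- The affine coordinates `v_j / v_i` (`j ≠ i`) of a vector `v` with `v_i ≠ 0`. -/
def affCoord {N : ℕ} (i : Fin (N + 1)) (v : Fin (N + 1) → ℂ) : Fin N → ℂ :=
  fun j => v (i.succAbove j) / v i

theorem rep_mk_eq {N : ℕ} (v : Fin (N + 1) → ℂ) (hv : v ≠ 0) :
    ∃ a : ℂ, a ≠ 0 ∧ (Projectivization.mk ℂ v hv).rep = a • v := by
  obtain ⟨a, ha⟩ := Projectivization.exists_smul_eq_mk_rep ℂ v hv
  exact ⟨a, a.ne_zero, by rw [← ha]; rfl⟩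

theorem rep_mk_ne_zero_iff {N : ℕ} (v : Fin (N + 1) → ℂ) (hv : v ≠ 0) (i : Fin (N + 1)) :
    (Projectivization.mk ℂ v hv).rep i ≠ 0 ↔ v i ≠ 0 := by
  obtain ⟨a, ha, h⟩ := rep_mk_eq v hv
  simp [h, ha]

theorem affCoord_rep_mk {N : ℕ} (v : Fin (N + 1) → ℂ) (hv : v ≠ 0) (i : Fin (N + 1)) :
    affCoord i (Projectivization.mk ℂ v hv).rep = affCoord i v := by
  obtain ⟨a, ha, h⟩ := rep_mk_eq v hv
  funext j
  simp only [affCoord, h, Pi.smul_apply, smul_eq_mul]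
  exact mul_div_mul_left _ _ ha

theorem isOpen_affDomain {N : ℕ} (i : Fin (N + 1)) : IsOpen {p : CP N | p.rep i ≠ 0} := by
  rw [isOpen_coinduced]
  have : (Projectivization.mk' ℂ ⁻¹' {p : CP N | p.rep i ≠ 0}) =
      {v : {v : Fin (N + 1) → ℂ // v ≠ 0} | v.1 i ≠ 0} := by
    ext v
    simp only [Set.mem_preimage, Set.mem_ofPred_eq, Projectivization.mk'_eq_mk]
    exact rep_mk_ne_zero_iff v.1 v.2 i
  rw [this]
  exact isOpen_ne_fun ((continuous_apply i).comp continuous_subtype_val) continuous_const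

theorem continuous_homCoord {N : ℕ} (i : Fin (N + 1)) :
    Continuous (homCoord i : (Fin N → ℂ) → Fin (N + 1) → ℂ) := by
  refine continuous_pi fun k => ?_
  induction k using Fin.succAboveCases i with
  | x => simpa [homCoord_self] using continuous_const
  | p j => simpa [homCoord_succAbove] using continuous_apply j

/-- The standard affine chart `[v] ↦ (v_j / v_i)_{j ≠ i}` on the open set `v_i ≠ 0`. -/
def affChart {N : ℕ} (i : Fin (N + 1)) : OpenPartialHomeomorph (CP N) (Fin N → ℂ) where
  toFun p := affCoord i p.rep
  invFun ζ := Projectivization.mk ℂ (homCoord i ζ) (homCoord_ne_zero i ζ)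
  source := {p | p.rep i ≠ 0}
  target := Set.univ
  map_source' _ _ := Set.mem_univ _
  map_target' ζ _ := by
    rw [Set.mem_ofPred_eq, rep_mk_ne_zero_iff, homCoord_self]; exact one_ne_zero
  left_inv' p hp := by
    have hp' : p.rep i ≠ 0 := hp
    conv_rhs => rw [← p.mk_rep]
    rw [Projectivization.mk_eq_mk_iff']
    refine ⟨(p.rep i)⁻¹, ?_⟩
    funext k
    induction k using Fin.succAboveCases i with
    | x => simp [homCoord_self, hp']
    | p j => simp [homCoord_succAbove, affCoord, div_eq_inv_mul]
  right_inv' ζ _ := by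
    rw [affCoord_rep_mk]
    funext j
    simp [affCoord, homCoord_self, homCoord_succAbove]
  open_source := isOpen_affDomain i
  open_target := isOpen_univ
  continuousOn_toFun := by
    have hq : Topology.IsQuotientMap
        (Projectivization.mk' ℂ : {v : Fin (N + 1) → ℂ // v ≠ 0} → CP N) :=
      ⟨⟨rfl⟩, Quotient.mk_surjective⟩
    refine (hq.continuousOn_isOpen_iff (isOpen_affDomain i)).2 ?_
    have : (fun p : CP N => affCoord i p.rep) ∘ Projectivization.mk' ℂ =
        fun v : {v : Fin (N + 1) → ℂ // v ≠ 0} => affCoord i v.1 := by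
      funext v
      exact affCoord_rep_mk v.1 v.2 i
    rw [this]
    refine continuousOn_pi.2 fun j => ?_
    refine ContinuousOn.div
      ((continuous_apply (i.succAbove j)).comp continuous_subtype_val).continuousOn
      ((continuous_apply i).comp continuous_subtype_val).continuousOn ?_
    intro v hv
    exact (rep_mk_ne_zero_iff v.1 v.2 i).1 hv
  continuousOn_invFun := by
    refine Continuous.continuousOn ?_
    exact (continuous_coinduced_rng (f := (Projectivization.mk' ℂ :
      {v : Fin (N + 1) → ℂ // v ≠ 0} → CP N))).comp
        ((continuous_homCoord i).subtype_mk (homCoord_ne_zero i))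

theorem mem_affChart_source {N : ℕ} {i : Fin (N + 1)} {p : CP N} :
    p ∈ (affChart i).source ↔ p.rep i ≠ 0 := Iff.rfl

theorem exists_mem_affChart {N : ℕ} (p : CP N) : ∃ i, p ∈ (affChart i).source :=
  Function.ne_iff.1 p.rep_nonzero

/-- The index of an affine chart around `p`. -/
def affIndex {N : ℕ} (p : CP N) : Fin (N + 1) := (exists_mem_affChart p).choose

theorem mem_affIndex {N : ℕ} (p : CP N) : p ∈ (affChart (affIndex p)).source :=
  (exists_mem_affChart p).choose_spec

/-- The atlas of the standard affine charts. -/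
instance instChartedSpaceCP (N : ℕ) : ChartedSpace (Fin N → ℂ) (CP N) where
  atlas := Set.range affChart
  chartAt p := affChart (affIndex p)
  mem_chart_source p := mem_affIndex p
  chart_mem_atlas _ := Set.mem_range_self _

/-- The change of affine coordinates from chart `i` to chart `k`. -/
def affTransition {N : ℕ} (i k : Fin (N + 1)) (ζ : Fin N → ℂ) : Fin N → ℂ :=
  affCoord k (homCoord i ζ)

theorem affChart_symm_trans {N : ℕ} (i k : Fin (N + 1)) (ζ : Fin N → ℂ) :
    affChart k ((affChart i).symm ζ) = affTransition i k ζ :=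
  affCoord_rep_mk _ (homCoord_ne_zero i ζ) k

theorem contDiff_homCoord {N : ℕ} (i : Fin (N + 1)) :
    ContDiff ℂ ω (homCoord i : (Fin N → ℂ) → Fin (N + 1) → ℂ) := by
  refine contDiff_pi.2 fun k => ?_
  induction k using Fin.succAboveCases i with
  | x => simpa [homCoord_self] using contDiff_const
  | p j => simpa [homCoord_succAbove] using contDiff_apply ℂ ℂ j

theorem contDiffOn_affTransition {N : ℕ} (i k : Fin (N + 1)) :
    ContDiffOn ℂ ω (affTransition i k : (Fin N → ℂ) → Fin N → ℂ) {ζ | homCoord i ζ k ≠ 0} := by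
  refine contDiffOn_pi.2 fun j => ?_
  exact ((contDiff_pi.1 (contDiff_homCoord i) _).contDiffOn).div
    ((contDiff_pi.1 (contDiff_homCoord i) _).contDiffOn) fun _ h => h

/-- Complex projective space is a complex (analytic) manifold. -/
instance instIsManifoldCP (N : ℕ) : IsManifold 𝓘(ℂ, Fin N → ℂ) ω (CP N) := by
  refine isManifold_of_contDiffOn _ _ _ ?_
  rintro _ _ ⟨i, rfl⟩ ⟨k, rfl⟩
  have h := contDiffOn_affTransition (N := N) i k
  simp only [modelWithCornersSelf_coe, modelWithCornersSelf_coe_symm, Function.id_comp,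
    Function.comp_id, Set.preimage_id, Set.range_id, Set.inter_univ]
  refine (h.mono ?_).congr ?_
  · rintro ζ ⟨-, hζ⟩
    exact (rep_mk_ne_zero_iff _ (homCoord_ne_zero i ζ) k).1 hζ
  · intro ζ _
    exact affChart_symm_trans i k ζ

/-! ### The holomorphic tangent bundle in affine coordinates and the Fubini-Study metric -/

/-- The holomorphic tangent space of complex projective space at `p`. -/
abbrev HolTangent {N : ℕ} (p : CP N) : Type := TangentSpace 𝓘(ℂ, Fin N → ℂ) p

/-- The components of a tangent vector at `p` in the holomorphic frame `∂/∂ζ₁, …, ∂/∂ζ_N` of the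
`i`-th affine chart. -/
def tangentCoord {N : ℕ} (i : Fin (N + 1)) (p : CP N) : HolTangent p →L[ℂ] (Fin N → ℂ) :=
  mfderiv 𝓘(ℂ, Fin N → ℂ) 𝓘(ℂ, Fin N → ℂ) (affChart i) p

/-- The tangent vector at `p` with given components in the frame of the `i`-th affine chart
(for `p` in that chart, `tangentCoord i p` is invertible). -/
def ofTangentCoord {N : ℕ} (i : Fin (N + 1)) (p : CP N) : (Fin N → ℂ) →L[ℂ] HolTangent p :=
  (tangentCoord i p).inverse

theorem affChart_mdifferentiable {N : ℕ} (i : Fin (N + 1)) :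
    (affChart (N := N) i).MDifferentiable 𝓘(ℂ, Fin N → ℂ) 𝓘(ℂ, Fin N → ℂ) :=
  haveI : IsManifold 𝓘(ℂ, Fin N → ℂ) 1 (CP N) := IsManifold.of_le (n := ω) le_top
  mdifferentiable_of_mem_atlas (Set.mem_range_self i)

theorem isInvertible_tangentCoord {N : ℕ} {i : Fin (N + 1)} {p : CP N}
    (hp : p ∈ (affChart i).source) : (tangentCoord i p).IsInvertible :=
  ⟨(affChart_mdifferentiable i).mfderiv hp, rfl⟩

theorem tangentCoord_ofTangentCoord {N : ℕ} {i : Fin (N + 1)} {p : CP N}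
    (hp : p ∈ (affChart i).source) (x : Fin N → ℂ) :
    tangentCoord i p (ofTangentCoord i p x) = x :=
  (isInvertible_tangentCoord hp).self_apply_inverse x

theorem tangentCoord_eq_fderiv {N : ℕ} {i k : Fin (N + 1)} {p : CP N}
    (hi : p ∈ (affChart i).source) (hk : p ∈ (affChart k).source) (ξ : HolTangent p) :
    tangentCoord k p ξ = fderiv ℂ (affTransition i k) (affChart i p) (tangentCoord i p ξ) := by
  have hd : DifferentiableAt ℂ (affTransition i k) (affChart i p) := by
    have ho : IsOpen {ζ : Fin N → ℂ | homCoord i ζ k ≠ 0} :=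
      isOpen_ne_fun ((continuous_apply k).comp (continuous_homCoord i)) continuous_const
    refine (((contDiffOn_affTransition i k).contDiffAt (ho.mem_nhds ?_)).differentiableAt
      (by simp))
    have h1 : p = (affChart i).symm (affChart i p) := ((affChart i).left_inv hi).symm
    rw [h1] at hk
    exact (rep_mk_ne_zero_iff _ (homCoord_ne_zero i _) k).1 hk
  have he : (affChart k : CP N → Fin N → ℂ) =ᶠ[nhds p] affTransition i k ∘ affChart i := by
    filter_upwards [(affChart i).open_source.mem_nhds hi] with q hq
    rw [Function.comp_apply, ← affChart_symm_trans, (affChart i).left_inv hq]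
  have hc := mfderiv_comp (I := 𝓘(ℂ, Fin N → ℂ)) (I' := 𝓘(ℂ, Fin N → ℂ))
    (I'' := 𝓘(ℂ, Fin N → ℂ)) p hd.mdifferentiableAt
    ((affChart_mdifferentiable i).mdifferentiableAt hi)
  unfold tangentCoord
  rw [he.mfderiv_eq, hc, mfderiv_eq_fderiv]
  rfl

/-- The (un-normalised) Fubini-Study form in affine coordinates `ζ`: the coefficients are
`∂² log (1 + |ζ|²) / ∂ζ_j ∂ζ̄_k`. -/
def fsForm {N : ℕ} (ζ x y : Fin N → ℂ) : ℂ :=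
  ((1 + ζ ⬝ᵥ star ζ) * (x ⬝ᵥ star y) - (x ⬝ᵥ star ζ) * (ζ ⬝ᵥ star y)) / (1 + ζ ⬝ᵥ star ζ) ^ 2

/-- The Fubini-Study metric, with the normalisation for which a holomorphic curve
`[f₀ : … : f_N]` has `|df|² = (1/4π) Δ log (|f₀|² + … + |f_N|²)`. It is linear in the first and
conjugate linear in the second argument. It is written in one affine chart around `p`;
`fubiniStudy_eq` shows that every affine chart around `p` gives the same value. -/
def fubiniStudy {N : ℕ} (p : CP N) (ξ η : HolTangent p) : ℂ :=
  (Real.pi : ℂ)⁻¹ * fsForm (affChart (affIndex p) p)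
    (tangentCoord (affIndex p) p ξ) (tangentCoord (affIndex p) p η)

theorem fsForm_eq_insertNth {N : ℕ} (i : Fin (N + 1)) (ζ x y : Fin N → ℂ)
    (v X Y : Fin (N + 1) → ℂ) (hv : v = homCoord i ζ)
    (hX : X = Fin.insertNth (α := fun _ => ℂ) i 0 x)
    (hY : Y = Fin.insertNth (α := fun _ => ℂ) i 0 y) :
    fsForm ζ x y = ((v ⬝ᵥ star v) * (X ⬝ᵥ star Y) - (X ⬝ᵥ star v) * (v ⬝ᵥ star Y)) /
      (v ⬝ᵥ star v) ^ 2 := by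
  subst hv hX hY
  simp [fsForm, dotProduct, Fin.sum_univ_succAbove _ i, homCoord]

theorem homCoord_affCoord {N : ℕ} (k : Fin (N + 1)) (v : Fin (N + 1) → ℂ) (hv : v k ≠ 0) :
    homCoord k (affCoord k v) = (v k)⁻¹ • v := by
  funext a
  induction a using Fin.succAboveCases k with
  | x => simp [homCoord_self, hv]
  | p j => simp [homCoord_succAbove, affCoord, div_eq_inv_mul]

theorem insertNth_fderiv_affTransition {N : ℕ} (i k : Fin (N + 1)) (ζ x : Fin N → ℂ)
    (v X : Fin (N + 1) → ℂ) (hv : v = homCoord i ζ)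
    (hX : X = Fin.insertNth (α := fun _ => ℂ) i 0 x) (hk : v k ≠ 0) :
    Fin.insertNth (α := fun _ => ℂ) k 0 (fderiv ℂ (affTransition i k) ζ x) =
      (v k)⁻¹ • X - (X k / v k ^ 2) • v := by
  have ho : IsOpen {ζ : Fin N → ℂ | homCoord i ζ k ≠ 0} :=
    isOpen_ne_fun ((continuous_apply k).comp (continuous_homCoord i)) continuous_const
  have hd : DifferentiableAt ℂ (affTransition i k) ζ :=
    ((contDiffOn_affTransition i k).contDiffAt (ho.mem_nhds (by subst hv; exact hk))).differentiableAt
      (by simp)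
  have hline : ∀ (a : Fin (N + 1)) (t : ℂ), homCoord i (ζ + t • x) a = v a + t * X a := by
    intro a t
    subst hv hX
    induction a using Fin.succAboveCases i with
    | x => simp [homCoord]
    | p j => simp [homCoord]
  funext a
  induction a using Fin.succAboveCases k with
  | x => simp; field_simp; ring
  | p j =>
    have h1 := hasDerivAt_pi.1 (hd.hasFDerivAt.hasLineDerivAt x) j
    have h2 : HasDerivAt (fun t : ℂ => (v (k.succAbove j) + t * X (k.succAbove j)) /
        (v k + t * X k)) ((X (k.succAbove j) * v k - v (k.succAbove j) * X k) / v k ^ 2) 0 := by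
      have hn : ∀ a : Fin (N + 1), HasDerivAt (fun t : ℂ => v a + t * X a) (X a) 0 := fun a => by
        simpa using ((hasDerivAt_id (0 : ℂ)).mul_const (X a)).const_add (v a)
      have h := HasDerivAt.fun_div (hn (k.succAbove j)) (hn k) (by simpa using hk)
      simpa using h
    have h3 := h1.unique (h2.congr_of_eventuallyEq (Filter.Eventually.of_forall fun t => by
      simp only [affTransition, affCoord, hline]))
    simp only [Fin.insertNth_apply_succAbove, h3, Pi.sub_apply, Pi.smul_apply, smul_eq_mul]
    field_simp

theorem fubiniStudy_eq {N : ℕ} {i : Fin (N + 1)} {p : CP N} (hp : p ∈ (affChart i).source)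
    (ξ η : HolTangent p) :
    fubiniStudy p ξ η =
      (Real.pi : ℂ)⁻¹ * fsForm (affChart i p) (tangentCoord i p ξ) (tangentCoord i p η) := by
  unfold fubiniStudy
  congr 1
  have hk := mem_affIndex p
  generalize affIndex p = k at hk
  rw [tangentCoord_eq_fderiv hp hk ξ, tangentCoord_eq_fderiv hp hk η]
  have hpk : affChart k p = affTransition i k (affChart i p) := by
    rw [← affChart_symm_trans, (affChart i).left_inv hp]
  rw [hpk]
  have hv : homCoord i (affChart i p) k ≠ 0 := by
    rw [← (affChart i).left_inv hp] at hk
    exact (rep_mk_ne_zero_iff _ (homCoord_ne_zero i _) k).1 hk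
  generalize affChart i p = ζ at hv ⊢
  generalize tangentCoord i p ξ = x
  generalize tangentCoord i p η = y
  rw [show affTransition i k ζ = affCoord k (homCoord i ζ) from rfl,
    fsForm_eq_insertNth k _ _ _ _ _ _ (homCoord_affCoord k _ hv).symm
    (insertNth_fderiv_affTransition i k ζ x _ _ rfl rfl hv).symm
    (insertNth_fderiv_affTransition i k ζ y _ _ rfl rfl hv).symm,
    fsForm_eq_insertNth i ζ x y _ _ _ rfl rfl rfl]
  generalize homCoord i ζ = v at hv ⊢
  generalize Fin.insertNth (α := fun _ => ℂ) i 0 x = X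
  generalize Fin.insertNth (α := fun _ => ℂ) i 0 y = Y
  simp only [star_sub, star_smul, dotProduct_sub, sub_dotProduct, smul_dotProduct,
    dotProduct_smul, smul_eq_mul]
  have hvs : star (v k) ≠ 0 := star_ne_zero.2 hv
  by_cases hvv : v ⬝ᵥ star v = 0
  · simp [hvv]
  simp only [star_inv₀, star_div₀, star_pow]
  field_simp
  ring

/-! ### The pulled-back tangent bundle over `ℂ/Λ`

Throughout, an object on `ℂ/Λ` is holomorphic or smooth when its pull-back to `ℂ` is: the
projection `ℂ → ℂ/Λ` is a local biholomorphism. -/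

/-- `φ : ℂ/Λ → ℂP^N` is holomorphic. -/
def IsHolomorphicMap {N : ℕ} {Λ : Submodule ℤ ℂ} (φ : ℂ ⧸ Λ → CP N) : Prop :=
  MDifferentiable 𝓘(ℂ, ℂ) 𝓘(ℂ, Fin N → ℂ) fun z : ℂ => φ (Submodule.Quotient.mk z)

/-- A smooth real valued function on `ℂ/Λ`. -/
def IsSmoothFunction {Λ : Submodule ℤ ℂ} (f : ℂ ⧸ Λ → ℝ) : Prop :=
  ContDiff ℝ ∞ fun z : ℂ => f (Submodule.Quotient.mk z)

/-- The points of `ℂ` that `φ` sends into the `i`-th affine chart; over this open set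
`φ^* T'ℂP^N` has the holomorphic frame `∂/∂ζ₁, …, ∂/∂ζ_N`. -/
def frameDomain {N : ℕ} {Λ : Submodule ℤ ℂ} (φ : ℂ ⧸ Λ → CP N) (i : Fin (N + 1)) : Set ℂ :=
  {z | φ (Submodule.Quotient.mk z) ∈ (affChart i).source}

/-- The smooth sections of `φ^* T'ℂP^N` over `ℂ/Λ`. -/
structure SmoothSection {N : ℕ} {Λ : Submodule ℤ ℂ} (φ : ℂ ⧸ Λ → CP N) where
  /-- the value of the section in the fibre over `p` -/
  val : ∀ p : ℂ ⧸ Λ, HolTangent (φ p)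
  smooth : ∀ i, ContDiffOn ℝ ∞
    (fun z : ℂ => tangentCoord i (φ (Submodule.Quotient.mk z)) (val (Submodule.Quotient.mk z)))
    (frameDomain φ i)

/-- The `j`-th vector of the holomorphic frame of the `i`-th affine chart, at `q`. -/
def frameVec {N : ℕ} (i : Fin (N + 1)) (q : CP N) (j : Fin N) : HolTangent q :=
  ofTangentCoord i q (Pi.single j 1)

/-- A (smooth) Hermitian metric on `φ^* T'ℂP^N`: a smoothly varying family of positive definite
Hermitian forms on the fibres, linear in the first argument. -/
structure HermitianMetric {N : ℕ} {Λ : Submodule ℤ ℂ} (φ : ℂ ⧸ Λ → CP N) where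
  /-- the inner product on the fibre over `p` -/
  inner : ∀ p : ℂ ⧸ Λ, HolTangent (φ p) → HolTangent (φ p) → ℂ
  add_left : ∀ p ξ₁ ξ₂ η, inner p (ξ₁ + ξ₂) η = inner p ξ₁ η + inner p ξ₂ η
  smul_left : ∀ p (c : ℂ) ξ η, inner p (c • ξ) η = c * inner p ξ η
  conj_symm : ∀ p ξ η, conj (inner p η ξ) = inner p ξ η
  pos : ∀ p ξ, ξ ≠ 0 → 0 < (inner p ξ ξ).re
  smooth : ∀ i j k, ContDiffOn ℝ ∞
    (fun z : ℂ => inner (Submodule.Quotient.mk z)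
      (frameVec i (φ (Submodule.Quotient.mk z)) j) (frameVec i (φ (Submodule.Quotient.mk z)) k))
    (frameDomain φ i)

/-! ### The canonical connection and its curvature -/

/-- `∂F/∂z = (∂F/∂x - √-1 ∂F/∂y) / 2`. -/
def dZ {E : Type*} [NormedAddCommGroup E] [NormedSpace ℂ E] (F : ℂ → E) (z : ℂ) : E :=
  (1 / 2 : ℂ) • (fderiv ℝ F z 1 - Complex.I • fderiv ℝ F z Complex.I)

/-- `∂F/∂z̄ = (∂F/∂x + √-1 ∂F/∂y) / 2`. -/
def dZbar {E : Type*} [NormedAddCommGroup E] [NormedSpace ℂ E] (F : ℂ → E) (z : ℂ) : E :=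
  (1 / 2 : ℂ) • (fderiv ℝ F z 1 + Complex.I • fderiv ℝ F z Complex.I)

namespace HermitianMetric

variable {N : ℕ} {Λ : Submodule ℤ ℂ} {φ : ℂ ⧸ Λ → CP N} (h : HermitianMetric φ)

/-- The Gram matrix `H_{jk} = h(e_j, e_k)` in the holomorphic frame of the `i`-th chart. -/
def gram (i : Fin (N + 1)) (z : ℂ) : Matrix (Fin N) (Fin N) ℂ :=
  Matrix.of fun j k => h.inner (Submodule.Quotient.mk z)
    (frameVec i (φ (Submodule.Quotient.mk z)) j) (frameVec i (φ (Submodule.Quotient.mk z)) k)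

/-- The matrix `A = (∂H/∂z · H⁻¹)ᵀ` of the canonical connection: `∇_{∂/∂z} e_j = ∑ₗ A_{lj} e_l`,
so that `h(∇_{∂/∂z} e_j, e_k) = ∂H_{jk}/∂z`. -/
def connMatrix (i : Fin (N + 1)) (z : ℂ) : Matrix (Fin N) (Fin N) ℂ :=
  ((Matrix.of fun j k => dZ (fun w => h.gram i w j k) z) * (h.gram i z)⁻¹)ᵀ

/-- `∇_{∂/∂z}` of the canonical connection, on components in the frame of the `i`-th chart. -/
def nablaZ (i : Fin (N + 1)) (s : ℂ → Fin N → ℂ) (z : ℂ) : Fin N → ℂ :=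
  dZ s z + h.connMatrix i z *ᵥ s z

/-- `∇_{∂/∂z̄}` of the canonical connection. In a holomorphic frame it is `∂/∂z̄` on components,
whatever the metric. -/
def nablaZbar (s : ℂ → Fin N → ℂ) (z : ℂ) : Fin N → ℂ := dZbar s z

/-- The curvature `R u = [∇_{∂/∂z}, ∇_{∂/∂z̄}] u` of the canonical connection of `h`, at (the image
of) `z`, computed in the frame of the `i`-th chart. -/
def curvature (i : Fin (N + 1)) (u : SmoothSection φ) (z : ℂ) :
    HolTangent (φ (Submodule.Quotient.mk z)) :=
  let s : ℂ → Fin N → ℂ := fun w =>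
    tangentCoord i (φ (Submodule.Quotient.mk w)) (u.val (Submodule.Quotient.mk w))
  ofTangentCoord i (φ (Submodule.Quotient.mk z))
    (h.nablaZ i (nablaZbar s) z - nablaZbar (h.nablaZ i s) z)

end HermitianMetric

end

/-! Write `ζ` for `φ` in an affine chart and `ζ'` for its derivative. In the holomorphic frame of
that chart the Chern connection of `e^{-f} h` has an explicit matrix, `fsConn`, and the commutator
of the two covariant derivatives (`fsConn_commutator`) is `R' s = ⟨s, ζ'⟩ ζ' + (|ζ'|² + f_{z z̄})
s`, with the un-normalised Fubini-Study form; the constant factor `1/π` of the metric does not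
affect the connection. Pairing with `s` turns the first term into a nonnegative square
(`inner_curvature`). It is therefore enough to find `f` with `|ζ'|² + f_{z z̄}` bounded below by a
positive constant.

The energy density `e = |ζ'|²` is chart independent, continuous, `Λ`-periodic, nonnegative and, as
`φ` is not constant, not identically zero, so its mean `m` over the torus is positive. Solving `f_{z
z̄} = m - e` would make the sum equal to `m`. An inequality suffices, and it spares elliptic
regularity: `e` is approximated uniformly by a trigonometric polynomial `p`, and the equation for
`p` is solved exactly, character by character (`exists_wirtinger_laplacian_eq`,
`exists_wirtinger_laplacian_ge`). Boundedness of `f` on the torus then compares `h'` with `h`. -/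

noncomputable section

/-! ### Wirtinger derivatives -/

/-- `f` is real differentiable at `z` with `∂f/∂z = a` and `∂f/∂z̄ = b`. -/
def HasWirtingerDerivAt (f : ℂ → ℂ) (a b z : ℂ) : Prop :=
  HasFDerivAt f (a • (1 : ℂ →L[ℝ] ℂ) + b • (Complex.conjCLE : ℂ →L[ℝ] ℂ)) z

namespace HasWirtingerDerivAt

variable {f g : ℂ → ℂ} {a b a' b' z : ℂ}

theorem dZ_eq (h : HasWirtingerDerivAt f a b z) : dZ f z = a := by
  rw [dZ, h.fderiv]
  simp only [_root_.add_apply, _root_.smul_apply,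
    one_apply_eq_self, ContinuousLinearEquiv.coe_coe, Complex.conjCLE_apply, map_one,
    Complex.conj_I, smul_eq_mul]
  linear_combination (-(1 / 2) * a + 1 / 2 * b) * Complex.I_mul_I

theorem dZbar_eq (h : HasWirtingerDerivAt f a b z) : dZbar f z = b := by
  rw [dZbar, h.fderiv]
  simp only [_root_.add_apply, _root_.smul_apply,
    one_apply_eq_self, ContinuousLinearEquiv.coe_coe, Complex.conjCLE_apply, map_one,
    Complex.conj_I, smul_eq_mul]
  linear_combination ((1 / 2) * a - 1 / 2 * b) * Complex.I_mul_I

/-- Reduces each rule below to the corresponding rule for real Fréchet derivatives and an algebraic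
identity in `v` and `conj v`. -/
theorem of_hasFDerivAt {L : ℂ →L[ℝ] ℂ} (h : HasFDerivAt f L z)
    (hL : ∀ v, L v = a * v + b * conj v) : HasWirtingerDerivAt f a b z := by
  have : L = a • (1 : ℂ →L[ℝ] ℂ) + b • (Complex.conjCLE : ℂ →L[ℝ] ℂ) := by
    ext v
    simp [hL]
  rw [HasWirtingerDerivAt, ← this]
  exact h

theorem differentiableAt (h : HasWirtingerDerivAt f a b z) : DifferentiableAt ℝ f z :=
  HasFDerivAt.differentiableAt h

theorem of_hasDerivAt (h : HasDerivAt f a z) : HasWirtingerDerivAt f a 0 z :=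
  of_hasFDerivAt (h.hasFDerivAt.restrictScalars ℝ) fun v => by simp [mul_comm]

theorem const (c z : ℂ) : HasWirtingerDerivAt (fun _ => c) 0 0 z :=
  of_hasFDerivAt (hasFDerivAt_const c z) fun v => by simp

theorem add (hf : HasWirtingerDerivAt f a b z) (hg : HasWirtingerDerivAt g a' b' z) :
    HasWirtingerDerivAt (fun w => f w + g w) (a + a') (b + b') z :=
  of_hasFDerivAt (HasFDerivAt.fun_add hf hg) fun v => by simp; ring

theorem neg (hf : HasWirtingerDerivAt f a b z) :
    HasWirtingerDerivAt (fun w => -f w) (-a) (-b) z :=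
  of_hasFDerivAt (HasFDerivAt.fun_neg hf) fun v => by simp; ring

theorem sub (hf : HasWirtingerDerivAt f a b z) (hg : HasWirtingerDerivAt g a' b' z) :
    HasWirtingerDerivAt (fun w => f w - g w) (a - a') (b - b') z :=
  of_hasFDerivAt (HasFDerivAt.fun_sub hf hg) fun v => by simp; ring

theorem mul (hf : HasWirtingerDerivAt f a b z) (hg : HasWirtingerDerivAt g a' b' z) :
    HasWirtingerDerivAt (fun w => f w * g w) (a * g z + f z * a') (b * g z + f z * b') z :=
  of_hasFDerivAt (HasFDerivAt.fun_mul hf hg) fun v => by simp; ring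

theorem const_mul (c : ℂ) (hf : HasWirtingerDerivAt f a b z) :
    HasWirtingerDerivAt (fun w => c * f w) (c * a) (c * b) z := by
  simpa using (const c z).mul hf

theorem sum {ι : Type*} (s : Finset ι) {F : ι → ℂ → ℂ} {A B : ι → ℂ}
    (h : ∀ i ∈ s, HasWirtingerDerivAt (F i) (A i) (B i) z) :
    HasWirtingerDerivAt (fun w => ∑ i ∈ s, F i w) (∑ i ∈ s, A i) (∑ i ∈ s, B i) z :=
  of_hasFDerivAt (HasFDerivAt.fun_sum h) fun v => by
    simp [Finset.sum_add_distrib, Finset.sum_mul]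

theorem comp_hasDerivAt {F : ℂ → ℂ} {F' : ℂ} (hF : HasDerivAt F F' (f z))
    (hf : HasWirtingerDerivAt f a b z) :
    HasWirtingerDerivAt (fun w => F (f w)) (F' * a) (F' * b) z :=
  of_hasFDerivAt ((hF.hasFDerivAt.restrictScalars ℝ).comp z hf) fun v => by simp; ring

theorem inv (hf : HasWirtingerDerivAt f a b z) (h0 : f z ≠ 0) :
    HasWirtingerDerivAt (fun w => (f w)⁻¹) (-(a / f z ^ 2)) (-(b / f z ^ 2)) z := by
  have := comp_hasDerivAt (hasDerivAt_inv h0) hf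
  convert this using 1 <;> ring

theorem cexp (hf : HasWirtingerDerivAt f a b z) :
    HasWirtingerDerivAt (fun w => Complex.exp (f w)) (Complex.exp (f z) * a)
      (Complex.exp (f z) * b) z :=
  comp_hasDerivAt (Complex.hasDerivAt_exp _) hf

theorem conjugate (hf : HasWirtingerDerivAt f a b z) :
    HasWirtingerDerivAt (fun w => star (f w)) (star b) (star a) z :=
  of_hasFDerivAt ((Complex.conjCLE : ℂ →L[ℝ] ℂ).hasFDerivAt.comp z hf) fun v => by
    simp [add_comm]

theorem congr_of_eventuallyEq (hf : HasWirtingerDerivAt f a b z) (h : g =ᶠ[nhds z] f) :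
    HasWirtingerDerivAt g a b z :=
  HasFDerivAt.congr_of_eventuallyEq hf h

theorem congr_deriv (hf : HasWirtingerDerivAt f a b z) (ha : a = a') (hb : b = b') :
    HasWirtingerDerivAt f a' b' z := ha ▸ hb ▸ hf

end HasWirtingerDerivAt

/-- Every real linear map `ℂ → ℂ` has the form `v ↦ a v + b v̄`; its values at `1` and `I` determine
`a` and `b`. -/
theorem DifferentiableAt.hasWirtingerDerivAt {f : ℂ → ℂ} {z : ℂ} (h : DifferentiableAt ℝ f z) :
    HasWirtingerDerivAt f (dZ f z) (dZbar f z) z := by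
  refine HasWirtingerDerivAt.of_hasFDerivAt h.hasFDerivAt fun v => ?_
  have hv : v = v.re • (1 : ℂ) + v.im • Complex.I := by simp
  conv_lhs => rw [hv, map_add, map_smul, map_smul]
  simp only [dZ, dZbar, smul_eq_mul, Complex.real_smul]
  generalize fderiv ℝ f z 1 = p
  generalize fderiv ℝ f z Complex.I = q
  have h1 : v = v.re + v.im * Complex.I := (Complex.re_add_im v).symm
  have h2 : conj v = v.re - v.im * Complex.I := by
    apply Complex.ext <;> simp
  rw [h2]
  conv_rhs => rw [show v = v.re + v.im * Complex.I from h1]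
  simp only [Complex.add_re, Complex.ofReal_re, Complex.mul_re, Complex.I_re, mul_zero,
    Complex.ofReal_im, Complex.I_im, mul_one, sub_self, add_zero, Complex.add_im, Complex.mul_im,
    zero_add]
  linear_combination (v.im : ℂ) * q * Complex.I_mul_I

theorem Filter.EventuallyEq.dZ_eq {f g : ℂ → ℂ} {z : ℂ} (h : f =ᶠ[nhds z] g) :
    dZ f z = dZ g z := by
  rw [dZ, dZ, h.fderiv_eq]

theorem Filter.EventuallyEq.dZbar_eq {f g : ℂ → ℂ} {z : ℂ} (h : f =ᶠ[nhds z] g) :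
    dZbar f z = dZbar g z := by
  rw [dZbar, dZbar, h.fderiv_eq]

theorem dZ_apply {ι : Type*} [Fintype ι] {s : ℂ → ι → ℂ} {z : ℂ} (h : DifferentiableAt ℝ s z)
    (l : ι) : dZ s z l = dZ (fun w => s w l) z := by
  have : fderiv ℝ (fun w => s w l) z = (ContinuousLinearMap.proj l).comp (fderiv ℝ s z) :=
    (hasFDerivAt_pi'.1 h.hasFDerivAt l).fderiv
  simp [dZ, this]

theorem dZbar_apply {ι : Type*} [Fintype ι] {s : ℂ → ι → ℂ} {z : ℂ} (h : DifferentiableAt ℝ s z)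
    (l : ι) : dZbar s z l = dZbar (fun w => s w l) z := by
  have : fderiv ℝ (fun w => s w l) z = (ContinuousLinearMap.proj l).comp (fderiv ℝ s z) :=
    (hasFDerivAt_pi'.1 h.hasFDerivAt l).fderiv
  simp [dZbar, this]

section Smooth

variable {E : Type*} [NormedAddCommGroup E] [NormedSpace ℂ E] {f : ℂ → E} {z : ℂ}

theorem ContDiffAt.dZ (h : ContDiffAt ℝ ∞ f z) : ContDiffAt ℝ ∞ (dZ f) z := by
  have h1 : ContDiffAt ℝ ∞ (fderiv ℝ f) z := h.fderiv_right (by simp)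
  exact ((h1.clm_apply contDiffAt_const).sub
    ((h1.clm_apply contDiffAt_const).const_smul Complex.I)).const_smul _

theorem ContDiffAt.dZbar (h : ContDiffAt ℝ ∞ f z) : ContDiffAt ℝ ∞ (dZbar f) z := by
  have h1 : ContDiffAt ℝ ∞ (fderiv ℝ f) z := h.fderiv_right (by simp)
  exact ((h1.clm_apply contDiffAt_const).add
    ((h1.clm_apply contDiffAt_const).const_smul Complex.I)).const_smul _

/-- The Wirtinger derivatives commute. -/
theorem dZ_dZbar_comm (h : ContDiffAt ℝ ∞ f z) : dZ (dZbar f) z = dZbar (dZ f) z := by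
  have h1 : DifferentiableAt ℝ (fderiv ℝ f) z :=
    (h.fderiv_right (m := ∞) (by simp)).differentiableAt (by simp)
  -- Both operators have constant coefficients, so they commute because the second derivative is
  -- symmetric.
  have hsymm : IsSymmSndFDerivAt ℝ f z := h.isSymmSndFDerivAt (by
    simpa using (WithTop.coe_le_coe.2 le_top : ((2 : ℕ∞) : WithTop ℕ∞) ≤ ∞))
  have hz : fderiv ℝ (dZ f) z = (1 / 2 : ℂ) • ((fderiv ℝ (fderiv ℝ f) z).flip 1 -
      Complex.I • (fderiv ℝ (fderiv ℝ f) z).flip Complex.I) :=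
    (((h1.hasFDerivAt.clm_apply (hasFDerivAt_const (1 : ℂ) z)).sub
      ((h1.hasFDerivAt.clm_apply (hasFDerivAt_const Complex.I z)).const_smul
        Complex.I)).const_smul (1 / 2 : ℂ)).fderiv.trans (by simp)
  have hzb : fderiv ℝ (dZbar f) z = (1 / 2 : ℂ) • ((fderiv ℝ (fderiv ℝ f) z).flip 1 +
      Complex.I • (fderiv ℝ (fderiv ℝ f) z).flip Complex.I) :=
    (((h1.hasFDerivAt.clm_apply (hasFDerivAt_const (1 : ℂ) z)).add
      ((h1.hasFDerivAt.clm_apply (hasFDerivAt_const Complex.I z)).const_smul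
        Complex.I)).const_smul (1 / 2 : ℂ)).fderiv.trans (by simp)
  rw [_root_.dZ, _root_.dZbar, hz, hzb]
  simp only [_root_.smul_apply, _root_.add_apply,
    _root_.sub_apply, ContinuousLinearMap.flip_apply]
  rw [hsymm.eq Complex.I 1]
  module

end Smooth

/-! ### A Poisson inequality on the torus `ℂ/Λ` -/

-- The integral is the inner product of the character `n` with the trivial character, so
-- orthonormality gives it.
open UnitAddTorus MeasureTheory in
theorem integral_mFourier {d : Type*} [Fintype d] (n : d → ℤ) :
    ∫ t, mFourier n t = if n = 0 then 1 else 0 := by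
  have h := orthonormal_iff_ite.1 (orthonormal_mFourier (d := d)) 0 n
  simp only [ContinuousMap.inner_toLp, ← mFourier_neg, ← mFourier_add] at h
  -- Orthonormality is stated for Haar probability measure, the integral for the volume of the
  -- circle; for period `1` they agree.
  have hvol : AddCircle.measureSpace 1 = (⟨AddCircle.haarAddCircle⟩ : MeasureSpace UnitAddCircle) := by
    have := AddCircle.volume_eq_smul_haarAddCircle (T := 1)
    rw [ENNReal.ofReal_one, one_smul] at this
    exact congrArg MeasureSpace.mk this
  have hpi : (@MeasureSpace.pi d _ (fun _ => UnitAddCircle) fun _ => AddCircle.measureSpace 1) =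
      @MeasureSpace.pi d _ (fun _ => UnitAddCircle) fun _ => ⟨AddCircle.haarAddCircle⟩ := by
    rw [hvol]
  rw [hpi]
  simpa [eq_comm] using h

section Torus

variable {ι : Type*} (b : Module.Basis ι ℝ ℂ)

/-- The projection of `ℂ` to the standard torus given by the coordinates of a basis. -/
def unitTorusMap (z : ℂ) : UnitAddTorus ι := fun i => (b.repr z i : UnitAddCircle)

theorem isOpenQuotientMap_unitTorusMap [Finite ι] : IsOpenQuotientMap (unitTorusMap b) := by
  have h1 : IsOpenQuotientMap (fun (x : ι → ℝ) (i : ι) => (x i : UnitAddCircle)) :=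
    IsOpenQuotientMap.piMap fun _ => QuotientAddGroup.isOpenQuotientMap_mk
  exact h1.comp b.equivFunL.toHomeomorph.isOpenQuotientMap

theorem unitTorusMap_add (z w : ℂ) : unitTorusMap b (z + w) = unitTorusMap b z + unitTorusMap b w := by
  funext i
  simp [unitTorusMap]

theorem unitTorusMap_eq_zero_iff (z : ℂ) :
    unitTorusMap b z = 0 ↔ z ∈ Submodule.span ℤ (Set.range b) := by
  rw [b.mem_span_iff_repr_mem ℤ, funext_iff]
  refine forall_congr' fun i => ?_
  simp only [unitTorusMap, Pi.zero_apply, AddCircle.coe_eq_zero_iff, Set.mem_range]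
  simp

variable [Fintype ι]

/-- The real linear functional `z ↦ ∑ nᵢ zᵢ` in the coordinates of a basis. -/
def freqFunctional (n : ι → ℤ) : ℂ →ₗ[ℝ] ℝ := ∑ i, (n i : ℝ) • b.coord i

theorem mFourier_unitTorusMap (n : ι → ℤ) (z : ℂ) :
    UnitAddTorus.mFourier n (unitTorusMap b z) =
      Complex.exp (2 * Real.pi * Complex.I * freqFunctional b n z) := by
  simp only [UnitAddTorus.mFourier, unitTorusMap, ContinuousMap.coe_mk, fourier_coe_apply,
    ← Complex.exp_sum, freqFunctional]
  congr 1
  simp [Finset.mul_sum, mul_assoc]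

theorem freqFunctional_ne_zero {n : ι → ℤ} (hn : n ≠ 0) : freqFunctional b n ≠ 0 := by
  classical
  obtain ⟨i, hi⟩ := Function.ne_iff.1 hn
  intro h
  apply hi
  have := LinearMap.congr_fun h (b i)
  simpa [freqFunctional, Finsupp.single_apply] using this

theorem hasWirtingerDerivAt_ofReal_linear (l : ℂ →ₗ[ℝ] ℝ) (z : ℂ) :
    HasWirtingerDerivAt (fun w => (l w : ℂ)) ((l 1 - Complex.I * l Complex.I) / 2)
      ((l 1 + Complex.I * l Complex.I) / 2) z := by
  refine HasWirtingerDerivAt.of_hasFDerivAt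
    ((Complex.ofRealCLM.comp l.toContinuousLinearMap).hasFDerivAt) fun v => ?_
  have hv : l v = v.re * l 1 + v.im * l Complex.I := by
    conv_lhs => rw [show v = v.re • (1 : ℂ) + v.im • Complex.I by simp, map_add, map_smul, map_smul]
    simp
  simp only [ContinuousLinearMap.comp_apply, LinearMap.coe_toContinuousLinearMap',
    Complex.ofRealCLM_apply, hv]
  apply Complex.ext <;> simp <;> ring

/-- Nontrivial characters are eigenfunctions of `∂²/∂z̄∂z` with nonzero eigenvalue and have mean
zero, while for the trivial character the right-hand side vanishes. Both sides are linear, so finite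
combinations follow, and smoothness needs no convergence argument. -/
theorem exists_wirtinger_laplacian_eq (p : C(UnitAddTorus ι, ℂ))
    (hp : p ∈ Submodule.span ℂ (Set.range (UnitAddTorus.mFourier (d := ι)))) :
    ∃ P : C(UnitAddTorus ι, ℂ), ContDiff ℝ ∞ (fun z => P (unitTorusMap b z)) ∧
      ∀ z, dZbar (dZ fun w => P (unitTorusMap b w)) z = (∫ t, p t) - p (unitTorusMap b z) := by
  have hadd : ∀ {G : ℂ → ℂ} {w}, ContDiffAt ℝ ∞ G w →
      HasWirtingerDerivAt G (dZ G w) (dZbar G w) w := fun h =>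
    (h.differentiableAt (by simp)).hasWirtingerDerivAt
  have hint : ∀ q : C(UnitAddTorus ι, ℂ), MeasureTheory.Integrable q := fun q =>
    q.continuous.integrable_of_hasCompactSupport (.of_compactSpace _)
  induction hp using Submodule.span_induction with
  | mem p hp =>
    obtain ⟨n, rfl⟩ := hp
    rw [integral_mFourier]
    by_cases hn : n = 0
    · refine ⟨0, contDiff_const, fun z => ?_⟩
      have h0 : (dZ fun w => (0 : C(UnitAddTorus ι, ℂ)) (unitTorusMap b w)) = fun _ => 0 :=
        funext fun w => (HasWirtingerDerivAt.const 0 w).dZ_eq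
      rw [h0, (HasWirtingerDerivAt.const 0 z).dZbar_eq]
      simp [hn, UnitAddTorus.mFourier_zero]
    · set l := freqFunctional b n with hl
      set α : ℂ := 2 * Real.pi * Complex.I * ((l 1 - Complex.I * l Complex.I) / 2) with hα
      set β : ℂ := 2 * Real.pi * Complex.I * ((l 1 + Complex.I * l Complex.I) / 2) with hβ
      -- The eigenvalue is `-π² (l(1)² + l(i)²)`. It vanishes only if `l` kills the real basis `1,
      -- i`, which forces the frequency to be zero.
      have hαβ : α * β ≠ 0 := by
        have h1 : α * β = ((-(Real.pi ^ 2 * (l 1 ^ 2 + l Complex.I ^ 2)) : ℝ) : ℂ) := by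
          rw [hα, hβ]
          push_cast
          linear_combination ((Real.pi : ℂ) ^ 2 * (l 1 ^ 2 -
            (Complex.I ^ 2 - 1) * (l Complex.I : ℂ) ^ 2)) * Complex.I_sq
        rw [h1, Ne, Complex.ofReal_eq_zero, neg_eq_zero, mul_eq_zero, not_or]
        refine ⟨by positivity, fun h => freqFunctional_ne_zero b hn ?_⟩
        have h2 : l 1 = 0 := by nlinarith [sq_nonneg (l 1), sq_nonneg (l Complex.I)]
        have h3 : l Complex.I = 0 := by nlinarith [sq_nonneg (l 1), sq_nonneg (l Complex.I)]
        refine LinearMap.ext fun v => ?_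
        rw [← hl, show v = v.re • (1 : ℂ) + v.im • Complex.I by simp, map_add, map_smul, map_smul,
          h2, h3]
        simp
      have hE : ∀ z, HasWirtingerDerivAt
          (fun w => Complex.exp (2 * Real.pi * Complex.I * l w))
          (Complex.exp (2 * Real.pi * Complex.I * l z) * α)
          (Complex.exp (2 * Real.pi * Complex.I * l z) * β) z := fun z =>
        ((hasWirtingerDerivAt_ofReal_linear l z).const_mul _).cexp
      refine ⟨(-(α * β)⁻¹) • UnitAddTorus.mFourier n, ?_, fun z => ?_⟩
      · simp only [ContinuousMap.smul_apply, mFourier_unitTorusMap]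
        simp only [smul_eq_mul]
        have hl' : ContDiff ℝ ∞ fun z => ((l z : ℝ) : ℂ) :=
          (Complex.ofRealCLM.comp l.toContinuousLinearMap).contDiff
        exact contDiff_const.mul (ContDiff.cexp (contDiff_const.mul hl'))
      · simp only [ContinuousMap.smul_apply, mFourier_unitTorusMap, smul_eq_mul, ← hl]
        have h1 : (dZ fun w => -(α * β)⁻¹ * Complex.exp (2 * Real.pi * Complex.I * l w)) =
            fun w => -(α * β)⁻¹ * α * Complex.exp (2 * Real.pi * Complex.I * l w) := by
          funext w
          rw [((hE w).const_mul _).dZ_eq]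
          ring
        rw [h1, ((hE z).const_mul _).dZbar_eq, if_neg hn]
        have hα0 := left_ne_zero_of_mul hαβ
        have hβ0 := right_ne_zero_of_mul hαβ
        field_simp
        ring
  | zero =>
    refine ⟨0, contDiff_const, fun z => ?_⟩
    have h0 : (dZ fun w => (0 : C(UnitAddTorus ι, ℂ)) (unitTorusMap b w)) = fun _ => 0 :=
      funext fun w => (HasWirtingerDerivAt.const 0 w).dZ_eq
    rw [h0, (HasWirtingerDerivAt.const 0 z).dZbar_eq]
    simp
  | add p q _ _ hp hq =>
    obtain ⟨P, hP, hPp⟩ := hp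
    obtain ⟨Q, hQ, hQq⟩ := hq
    refine ⟨P + Q, hP.add hQ, fun z => ?_⟩
    have h1 : (dZ fun w => (P + Q) (unitTorusMap b w)) =
        fun w => dZ (fun w => P (unitTorusMap b w)) w + dZ (fun w => Q (unitTorusMap b w)) w :=
      funext fun w => ((hadd hP.contDiffAt).add (hadd hQ.contDiffAt)).dZ_eq
    rw [h1, ((hadd hP.contDiffAt.dZ).add (hadd hQ.contDiffAt.dZ)).dZbar_eq, hPp, hQq]
    simp only [ContinuousMap.add_apply]
    rw [MeasureTheory.integral_add (hint p) (hint q)]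
    ring
  | smul c p _ hp =>
    obtain ⟨P, hP, hPp⟩ := hp
    refine ⟨c • P, contDiff_const.smul hP, fun z => ?_⟩
    have h1 : (dZ fun w => (c • P) (unitTorusMap b w)) =
        fun w => c * dZ (fun w => P (unitTorusMap b w)) w :=
      funext fun w => ((hadd hP.contDiffAt).const_mul c).dZ_eq
    rw [h1, ((hadd hP.contDiffAt.dZ).const_mul c).dZbar_eq, hPp]
    simp only [ContinuousMap.smul_apply, smul_eq_mul]
    rw [MeasureTheory.integral_const_mul]
    ring

end Torus

/-- If a trigonometric polynomial `p` is close to `e` and `F_{z z̄} = Re (∫ p - p)`, then `e + F_{z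
z̄}` is close to the mean of `e`, which is positive. -/
theorem exists_wirtinger_laplacian_ge (Λ : Submodule ℤ ℂ) [DiscreteTopology Λ] [IsZLattice ℝ Λ]
    (e : ℂ → ℝ) (he : Continuous e) (hper : ∀ z, ∀ l ∈ Λ, e (z + l) = e z) (h0 : ∀ z, 0 ≤ e z)
    (hpos : ∃ z, e z ≠ 0) :
    ∃ (F : ℂ → ℝ) (c M : ℝ), 0 < c ∧ ContDiff ℝ ∞ F ∧ (∀ z, ∀ l ∈ Λ, F (z + l) = F z) ∧
      (∀ z, F z ≤ M) ∧
      ∀ z, ∃ r : ℝ, dZbar (dZ fun w => (F w : ℂ)) z = r ∧ c ≤ e z + r := by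
  have : Module.Free ℤ Λ := ZLattice.module_free ℝ Λ
  have : Module.Finite ℤ Λ := ZLattice.module_finite ℝ Λ
  -- In real coordinates along a `ℤ`-basis of `Λ`, the kernel of `unitTorusMap b` is exactly `Λ`, so
  -- `Λ`-periodic functions descend to the standard torus.
  let b := (Module.Free.chooseBasis ℤ Λ).ofZLatticeBasis ℝ Λ
  have hb : Submodule.span ℤ (Set.range b) = Λ := Module.Basis.ofZLatticeBasis_span ..
  have hq := isOpenQuotientMap_unitTorusMap b
  obtain ⟨E, hE⟩ : ∃ E : C(UnitAddTorus (Module.Free.ChooseBasisIndex ℤ Λ), ℝ),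
      ∀ z, E (unitTorusMap b z) = e z := by
    have hf : Function.FactorsThrough e (unitTorusMap b) := fun z w hzw => by
      have h := unitTorusMap_add b (z - w) w
      rw [sub_add_cancel, hzw, right_eq_add, unitTorusMap_eq_zero_iff, hb] at h
      simpa using hper w _ h
    have hq' : Topology.IsQuotientMap (⟨_, hq.continuous⟩ : C(ℂ, _)) := hq.isQuotientMap
    exact ⟨hq'.lift ⟨e, he⟩ hf, DFunLike.congr_fun (hq'.lift_comp ⟨e, he⟩ hf)⟩
  have hEnn : 0 ≤ (E : _ → ℝ) := fun t => by
    obtain ⟨z, rfl⟩ := hq.surjective t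
    simpa [hE] using h0 z
  obtain ⟨z₀, hz₀⟩ := hpos
  have hEint : 0 < ∫ t, E t :=
    E.continuous.integral_pos_of_hasCompactSupport_nonneg_nonzero (.of_compactSpace _) hEnn
      (x := unitTorusMap b z₀) (by rwa [hE])
  set m := ∫ t, E t with hm
  let EC : C(UnitAddTorus (Module.Free.ChooseBasisIndex ℤ Λ), ℂ) := ⟨fun t => E t, by fun_prop⟩
  have hEC : EC ∈ closure (Submodule.span ℂ
      (Set.range (UnitAddTorus.mFourier (d := Module.Free.ChooseBasisIndex ℤ Λ))) : Set _) := by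
    rw [← Submodule.topologicalClosure_coe, UnitAddTorus.span_mFourier_closure_eq_top]
    trivial
  -- Tolerance `m / 4` enters twice, for `p` against `e` and for the mean of `p` against `m`. What
  -- remains is `m / 2`, more than the `m / 4` claimed.
  obtain ⟨p, hp, hEp⟩ := Metric.mem_closure_iff.1 hEC (m / 4) (by linarith)
  obtain ⟨P, hP, hPp⟩ := exists_wirtinger_laplacian_eq b p hp
  have hclose : ∀ t, |E t - (p t).re| ≤ m / 4 := fun t => by
    have h1 := ContinuousMap.dist_apply_le_dist (f := EC) (g := p) t
    have h2 := Complex.abs_re_le_norm (EC t - p t)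
    rw [dist_eq_norm] at h1
    simpa [EC] using h2.trans (h1.trans hEp.le)
  have hint : |m - (∫ t, p t).re| ≤ m / 4 := by
    have hpi : MeasureTheory.Integrable p := p.continuous.integrable_of_hasCompactSupport
      (.of_compactSpace _)
    have hEi : MeasureTheory.Integrable E := E.continuous.integrable_of_hasCompactSupport
      (.of_compactSpace _)
    have h1 : (∫ t, p t).re = ∫ t, (p t).re := (integral_re hpi).symm
    rw [h1, hm, ← MeasureTheory.integral_sub (g := fun t => (p t).re) hEi hpi.re]
    have := MeasureTheory.norm_integral_le_of_norm_le_const (μ := MeasureTheory.volume)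
      (f := fun t => E t - (p t).re) (.of_forall hclose)
    -- The torus has total mass `1`: this is the integral of the trivial character.
    have hv : MeasureTheory.volume.real
        (Set.univ : Set (UnitAddTorus (Module.Free.ChooseBasisIndex ℤ Λ))) = 1 := by
      have h := integral_mFourier (d := Module.Free.ChooseBasisIndex ℤ Λ) 0
      simpa [UnitAddTorus.mFourier_zero] using h
    rwa [hv, mul_one] at this
  refine ⟨fun z => (P (unitTorusMap b z)).re, m / 4, ‖P‖, by linarith, ?_, fun z l hl => ?_,
    fun z => (Complex.re_le_norm _).trans (P.norm_coe_le_norm _), fun z =>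
    ⟨((∫ t, p t) - p (unitTorusMap b z)).re, ?_, ?_⟩⟩
  · exact Complex.reCLM.contDiff.comp hP
  · dsimp only
    rw [unitTorusMap_add, (unitTorusMap_eq_zero_iff b l).2 (by rwa [hb]), add_zero]
  · rw [← hPp z]
    set Q : ℂ → ℂ := fun w => P (unitTorusMap b w) with hQ
    have hQs : ∀ w, ContDiffAt ℝ ∞ Q w := fun w => hP.contDiffAt
    have hd : ∀ {G : ℂ → ℂ} {w}, ContDiffAt ℝ ∞ G w →
        HasWirtingerDerivAt G (dZ G w) (dZbar G w) w := fun h =>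
      (h.differentiableAt (by simp)).hasWirtingerDerivAt
    have hre : ∀ G : ℂ → ℂ, (fun w => ((G w).re : ℂ)) = fun w => 1 / 2 * (G w + star (G w)) := by
      intro G
      funext w
      rw [Complex.star_def, Complex.add_conj]
      push_cast
      ring
    -- Conjugation exchanges `∂/∂z` and `∂/∂z̄`. As these commute, the Laplacian of a real part is
    -- the real part of the Laplacian.
    have h1 : (dZ fun w => ((Q w).re : ℂ)) = fun w => 1 / 2 * (dZ Q w + star (dZbar Q w)) := by
      funext w
      rw [hre]
      exact (((hd (hQs w)).add (hd (hQs w)).conjugate).const_mul _).dZ_eq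
    rw [h1, (((hd (hQs z).dZ).add (hd (hQs z).dZbar).conjugate).const_mul _).dZbar_eq,
      dZ_dZbar_comm (hQs z), Complex.star_def, Complex.add_conj]
    push_cast
    ring
  · have h1 := abs_le.1 (hclose (unitTorusMap b z))
    have h2 := abs_le.1 hint
    rw [hE] at h1
    simp only [Complex.sub_re]
    linarith [h1.1, h2.2]

/-! ### The Fubini-Study form -/

section FubiniStudyForm

variable {N : ℕ} (ζ : Fin N → ℂ)

theorem fsForm_add_left (x₁ x₂ y : Fin N → ℂ) :
    fsForm ζ (x₁ + x₂) y = fsForm ζ x₁ y + fsForm ζ x₂ y := by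
  simp only [fsForm, add_dotProduct]
  ring

theorem fsForm_smul_left (c : ℂ) (x y : Fin N → ℂ) : fsForm ζ (c • x) y = c * fsForm ζ x y := by
  simp only [fsForm, smul_dotProduct, smul_eq_mul]
  ring

theorem star_dotProduct_star_comm (x y : Fin N → ℂ) : star (x ⬝ᵥ star y) = y ⬝ᵥ star x := by
  rw [← Matrix.star_dotProduct_star, star_star]

theorem star_fsForm (x y : Fin N → ℂ) : star (fsForm ζ x y) = fsForm ζ y x := by
  simp only [fsForm, star_div₀, star_sub, star_mul', star_add, star_one, star_pow,
    star_dotProduct_star_comm]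
  ring

theorem fsForm_sum_left {ι : Type*} (s : Finset ι) (x : ι → Fin N → ℂ) (y : Fin N → ℂ) :
    fsForm ζ (∑ i ∈ s, x i) y = ∑ i ∈ s, fsForm ζ (x i) y :=
  map_sum (⟨⟨fun x => fsForm ζ x y, by simpa using fsForm_smul_left ζ 0 0 y⟩,
    fun a b => fsForm_add_left ζ a b y⟩ : (Fin N → ℂ) →+ ℂ) x s

theorem fsForm_eq_sum_left (x y : Fin N → ℂ) :
    fsForm ζ x y = ∑ l, x l * fsForm ζ (Pi.single l 1) y := by
  conv_lhs => rw [pi_eq_sum_univ' x, fsForm_sum_left]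
  simp_rw [fsForm_smul_left]

theorem fsForm_eq_sum_right (x y : Fin N → ℂ) :
    fsForm ζ x y = ∑ k, star (y k) * fsForm ζ x (Pi.single k 1) := by
  rw [← star_fsForm, fsForm_eq_sum_left, star_sum]
  simp only [star_mul', star_fsForm]

theorem dotProduct_star_self_eq (x : Fin N → ℂ) :
    x ⬝ᵥ star x = ((‖WithLp.toLp 2 x‖ ^ 2 : ℝ) : ℂ) := by
  have := inner_self_eq_norm_sq_to_K (𝕜 := ℂ) (WithLp.toLp 2 x)
  rw [EuclideanSpace.inner_eq_star_dotProduct] at this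
  simpa using this

theorem one_add_dotProduct_star_ne_zero : 1 + ζ ⬝ᵥ star ζ ≠ 0 := by
  rw [dotProduct_star_self_eq]
  have : (0 : ℝ) < 1 + ‖WithLp.toLp 2 ζ‖ ^ 2 := by positivity
  exact_mod_cast this.ne'

theorem fsForm_self_im (x : Fin N → ℂ) : (fsForm ζ x x).im = 0 :=
  Complex.conj_eq_iff_im.1 (star_fsForm ζ x x)

/-- The numerator is `|x|² + (|ζ|²|x|² - |⟨x, ζ⟩|²)`, and Cauchy-Schwarz makes the bracket
nonnegative. -/
theorem fsForm_self_re_pos {x : Fin N → ℂ} (hx : x ≠ 0) : 0 < (fsForm ζ x x).re := by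
  have hxy : (x ⬝ᵥ star ζ) * (ζ ⬝ᵥ star x) = ((‖x ⬝ᵥ star ζ‖ ^ 2 : ℝ) : ℂ) := by
    rw [← star_dotProduct_star_comm x ζ, Complex.star_def, Complex.mul_conj, Complex.normSq_eq_norm_sq]
  have hcs : ‖x ⬝ᵥ star ζ‖ ≤ ‖WithLp.toLp 2 ζ‖ * ‖WithLp.toLp 2 x‖ := by
    have := norm_inner_le_norm (𝕜 := ℂ) (WithLp.toLp 2 ζ) (WithLp.toLp 2 x)
    rwa [EuclideanSpace.inner_eq_star_dotProduct] at this
  have hc := norm_nonneg (x ⬝ᵥ star ζ)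
  have hxp : 0 < ‖WithLp.toLp 2 x‖ := by simpa using hx
  rw [fsForm, dotProduct_star_self_eq, dotProduct_star_self_eq, hxy]
  generalize ‖WithLp.toLp 2 x‖ = a at *
  generalize ‖WithLp.toLp 2 ζ‖ = b at *
  generalize ‖x ⬝ᵥ star ζ‖ = c at *
  have : (((1 + ((b ^ 2 : ℝ) : ℂ)) * ((a ^ 2 : ℝ) : ℂ) - ((c ^ 2 : ℝ) : ℂ)) /
      (1 + ((b ^ 2 : ℝ) : ℂ)) ^ 2) = ((((1 + b ^ 2) * a ^ 2 - c ^ 2) / (1 + b ^ 2) ^ 2 : ℝ) : ℂ) := by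
    push_cast
    rfl
  rw [this, Complex.ofReal_re]
  have h2 : c ^ 2 ≤ (b * a) ^ 2 := pow_le_pow_left₀ hc hcs 2
  exact div_pos (by nlinarith [pow_pos hxp 2]) (by positivity)

theorem fsForm_self_re_nonneg (x : Fin N → ℂ) : 0 ≤ (fsForm ζ x x).re := by
  by_cases hx : x = 0
  · subst hx
    simp [fsForm]
  · exact (fsForm_self_re_pos ζ hx).le

end FubiniStudyForm

theorem HasWirtingerDerivAt.dotProduct_star {N : ℕ} {x y : ℂ → Fin N → ℂ}
    {a b a' b' : Fin N → ℂ} {z : ℂ}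
    (hx : ∀ j, HasWirtingerDerivAt (fun w => x w j) (a j) (b j) z)
    (hy : ∀ j, HasWirtingerDerivAt (fun w => y w j) (a' j) (b' j) z) :
    HasWirtingerDerivAt (fun w => x w ⬝ᵥ star (y w)) (a ⬝ᵥ star (y z) + x z ⬝ᵥ star b')
      (b ⬝ᵥ star (y z) + x z ⬝ᵥ star a') z := by
  refine (HasWirtingerDerivAt.sum Finset.univ fun j _ => (hx j).mul (hy j).conjugate).congr_deriv ?_ ?_
  all_goals simp [dotProduct, Finset.sum_add_distrib]

/-! ### The canonical connection of a conformal change of the Fubini-Study metric -/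

section Connection

variable {N : ℕ}

/-- The connection matrix at `ζ` in direction `ζ'` of `e^{-F}` times the Fubini-Study metric, where
`τ = ∂F/∂z`. -/
def fsConn (ζ ζ' : Fin N → ℂ) (τ : ℂ) : Matrix (Fin N) (Fin N) ℂ :=
  Matrix.of fun l j => -(star (ζ j) / (1 + ζ ⬝ᵥ star ζ) * ζ' l) -
    ((ζ' ⬝ᵥ star ζ) / (1 + ζ ⬝ᵥ star ζ) + τ) * (1 : Matrix (Fin N) (Fin N) ℂ) l j

theorem fsConn_mulVec (ζ ζ' : Fin N → ℂ) (τ : ℂ) (s : Fin N → ℂ) (l : Fin N) :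
    (fsConn ζ ζ' τ *ᵥ s) l = -((s ⬝ᵥ star ζ) * (1 + ζ ⬝ᵥ star ζ)⁻¹ * ζ' l) -
      ((ζ' ⬝ᵥ star ζ) * (1 + ζ ⬝ᵥ star ζ)⁻¹ + τ) * s l := by
  have h1 : ∑ j, (1 : Matrix (Fin N) (Fin N) ℂ) l j * s j = s l := by
    simpa [Matrix.mulVec, dotProduct] using congrFun (Matrix.one_mulVec s) l
  simp only [Matrix.mulVec, dotProduct, fsConn, Matrix.of_apply, sub_mul, Finset.sum_sub_distrib,
    mul_assoc, ← Finset.mul_sum, h1]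
  congr 1
  rw [Finset.sum_mul, ← Finset.sum_neg_distrib]
  refine Finset.sum_congr rfl fun j _ => ?_
  rw [Pi.star_apply]
  ring

theorem sum_fsConn_mul_fsForm (ζ ζ' y : Fin N → ℂ) (τ : ℂ) (j : Fin N) :
    ∑ l, fsConn ζ ζ' τ l j * fsForm ζ (Pi.single l 1) y =
      -(star (ζ j) / (1 + ζ ⬝ᵥ star ζ) * fsForm ζ ζ' y) -
        ((ζ' ⬝ᵥ star ζ) / (1 + ζ ⬝ᵥ star ζ) + τ) * fsForm ζ (Pi.single j 1) y := by
  have h1 : ∑ l, (1 : Matrix (Fin N) (Fin N) ℂ) l j * fsForm ζ (Pi.single l 1) y =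
      fsForm ζ (Pi.single j 1) y := by
    simp [Matrix.one_apply]
  rw [fsForm_eq_sum_left ζ ζ' y]
  simp only [fsConn, Matrix.of_apply, sub_mul, neg_mul, Finset.sum_sub_distrib,
    Finset.sum_neg_distrib, mul_assoc, ← Finset.mul_sum, h1]

variable {ζ ζ' : ℂ → Fin N → ℂ} {z : ℂ}

/-- This is `∂H/∂z = Aᵀ H` for the Gram matrix `H` and `A = fsConn`, the relation that characterises
the Chern connection. Since `ζ` is holomorphic, `∂/∂z` does not see `ζ̄`. The `z̄`-derivative plays
no role and is left unspecified. -/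
theorem hasWirtingerDerivAt_fsForm_single (hζ : ∀ j, HasDerivAt (fun w => ζ w j) (ζ' z j) z)
    {F : ℂ → ℂ} {τ τ' : ℂ} (hF : HasWirtingerDerivAt F τ τ' z) (c : ℂ) (j k : Fin N) :
    ∃ b, HasWirtingerDerivAt
      (fun w => Complex.exp (-F w) * (c * fsForm (ζ w) (Pi.single j 1) (Pi.single k 1)))
      (∑ l, fsConn (ζ z) (ζ' z) τ l j *
        (Complex.exp (-F z) * (c * fsForm (ζ z) (Pi.single l 1) (Pi.single k 1)))) b z := by
  have hW := fun j => HasWirtingerDerivAt.of_hasDerivAt (hζ j)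
  have hρ := (HasWirtingerDerivAt.const 1 z).add (HasWirtingerDerivAt.dotProduct_star hW hW)
  have h0 := one_add_dotProduct_star_ne_zero (ζ z)
  set δ : ℂ := (Pi.single j 1 : Fin N → ℂ) ⬝ᵥ star (Pi.single k 1 : Fin N → ℂ) with hδ
  have hnum := (hρ.mul (HasWirtingerDerivAt.const δ z)).sub ((hW j).conjugate.mul (hW k))
  have hfs := hnum.mul ((hρ.mul hρ).inv (mul_ne_zero h0 h0))
  have h := hF.neg.cexp.mul (hfs.const_mul c)
  have hform : ∀ w, fsForm (ζ w) (Pi.single j 1) (Pi.single k 1) =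
      ((1 + ζ w ⬝ᵥ star (ζ w)) * δ - star (ζ w j) * ζ w k) *
        ((1 + ζ w ⬝ᵥ star (ζ w)) * (1 + ζ w ⬝ᵥ star (ζ w)))⁻¹ := by
    intro w
    rw [fsForm, ← hδ, ← Pi.single_star]
    simp [div_eq_mul_inv, pow_two]
  have hform' : fsForm (ζ z) (ζ' z) (Pi.single k 1) =
      ((1 + ζ z ⬝ᵥ star (ζ z)) * ζ' z k - ζ' z ⬝ᵥ star (ζ z) * ζ z k) *
        ((1 + ζ z ⬝ᵥ star (ζ z)) * (1 + ζ z ⬝ᵥ star (ζ z)))⁻¹ := by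
    rw [fsForm, ← Pi.single_star]
    simp [div_eq_mul_inv, pow_two]
  refine ⟨_, (h.congr_of_eventuallyEq (.of_forall fun w => ?_)).congr_deriv ?_ rfl⟩
  · simp only [hform]
  · have hs : ∀ l, fsConn (ζ z) (ζ' z) τ l j *
        (Complex.exp (-F z) * (c * fsForm (ζ z) (Pi.single l 1) (Pi.single k 1))) =
        Complex.exp (-F z) * c *
          (fsConn (ζ z) (ζ' z) τ l j * fsForm (ζ z) (Pi.single l 1) (Pi.single k 1)) :=
      fun l => by ring
    simp only [hs]
    rw [← Finset.mul_sum, sum_fsConn_mul_fsForm, hform, hform']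
    simp only [star_zero, zero_mul, mul_zero, add_zero, zero_add]
    have e0 : ζ z ⬝ᵥ star (fun _ => 0 : Fin N → ℂ) = 0 := by simp [dotProduct]
    rw [show (ζ z ⬝ᵥ star fun j => (0 : ℂ)) = 0 from e0]
    generalize ζ z ⬝ᵥ star (ζ z) = n at *
    generalize ζ' z ⬝ᵥ star (ζ z) = σ at *
    field_simp
    ring

/-- The commutator of the covariant derivatives in coordinates. -/
theorem fsConn_commutator {D : Set ℂ} (hD : IsOpen D)
    (hζ : ∀ w ∈ D, ∀ j, HasDerivAt (fun w => ζ w j) (ζ' w j) w)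
    (hζ' : ∀ w ∈ D, ∀ j, DifferentiableAt ℂ (fun w => ζ' w j) w)
    {τ : ℂ → ℂ} (hτ : DifferentiableAt ℝ τ z)
    {s : ℂ → Fin N → ℂ} (hs : ContDiffOn ℝ ∞ s D) (hz : z ∈ D) :
    dZ (dZbar s) z + fsConn (ζ z) (ζ' z) (τ z) *ᵥ dZbar s z -
      dZbar (fun w => dZ s w + fsConn (ζ w) (ζ' w) (τ w) *ᵥ s w) z =
    fsForm (ζ z) (s z) (ζ' z) • ζ' z + (fsForm (ζ z) (ζ' z) (ζ' z) + dZbar τ z) • s z := by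
  have hsz : ContDiffAt ℝ ∞ s z := hs.contDiffAt (hD.mem_nhds hz)
  have hsl : ∀ l, HasWirtingerDerivAt (fun w => s w l) (dZ s z l) (dZbar s z l) z := fun l => by
    have hd := hsz.differentiableAt (by simp)
    rw [dZ_apply hd, dZbar_apply hd]
    exact (differentiableAt_pi.1 hd l).hasWirtingerDerivAt
  have hdsl : ∀ l, HasWirtingerDerivAt (fun w => dZ s w l) (dZ (dZ s) z l) (dZbar (dZ s) z l) z :=
    fun l => by
      have hd := hsz.dZ.differentiableAt (by simp)
      rw [dZ_apply hd, dZbar_apply hd]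
      exact (differentiableAt_pi.1 hd l).hasWirtingerDerivAt
  have hW := fun j => HasWirtingerDerivAt.of_hasDerivAt (hζ z hz j)
  have hW' := fun j => HasWirtingerDerivAt.of_hasDerivAt (hζ' z hz j).hasDerivAt
  have h0 := one_add_dotProduct_star_ne_zero (ζ z)
  have hρ := ((HasWirtingerDerivAt.const 1 z).add (HasWirtingerDerivAt.dotProduct_star hW hW)).inv h0
  -- As `ζ` and `ζ'` are holomorphic, `∂/∂z̄` falls only on `s`, `τ` and `ζ̄`. The terms where it
  -- falls on `ζ̄` assemble into the two Fubini-Study forms; those where it falls on `s` cancel in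
  -- the commutator.
  have hcomp : ∀ l, ∃ a, HasWirtingerDerivAt
      (fun w => (dZ s w + fsConn (ζ w) (ζ' w) (τ w) *ᵥ s w) l) a
      (dZbar (dZ s) z l + (fsConn (ζ z) (ζ' z) (τ z) *ᵥ dZbar s z) l -
        fsForm (ζ z) (s z) (ζ' z) * ζ' z l -
        (fsForm (ζ z) (ζ' z) (ζ' z) + dZbar τ z) * s z l) z := fun l => by
    have h := (hdsl l).add
      ((((HasWirtingerDerivAt.dotProduct_star hsl hW).mul hρ).mul (hW' l)).neg.sub
        ((((HasWirtingerDerivAt.dotProduct_star hW' hW).mul hρ).add hτ.hasWirtingerDerivAt).mul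
          (hsl l)))
    refine ⟨_, (h.congr_of_eventuallyEq (.of_forall fun w => ?_)).congr_deriv rfl ?_⟩
    · simp only [Pi.add_apply, fsConn_mulVec]
    · rw [fsConn_mulVec, fsForm, fsForm]
      have e0 : (fun _ => 0 : Fin N → ℂ) ⬝ᵥ star (ζ z) = 0 := by simp [dotProduct]
      simp only [e0]
      generalize ζ z ⬝ᵥ star (ζ z) = n at *
      generalize ζ z ⬝ᵥ star (ζ' z) = m at *
      generalize ζ' z ⬝ᵥ star (ζ z) = σ at *
      field_simp
      ring
  have hdiff : DifferentiableAt ℝ (fun w => dZ s w + fsConn (ζ w) (ζ' w) (τ w) *ᵥ s w) z :=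
    differentiableAt_pi.2 fun l => (hcomp l).choose_spec.differentiableAt
  funext l
  simp only [Pi.sub_apply, Pi.add_apply, Pi.smul_apply, smul_eq_mul]
  rw [dZbar_apply hdiff, (hcomp l).choose_spec.dZbar_eq, dZ_dZbar_comm hsz]
  ring

end Connection

/-! ### The pulled-back metric -/

theorem tangentCoord_frameVec {N : ℕ} {i : Fin (N + 1)} {p : CP N} (hp : p ∈ (affChart i).source)
    (j : Fin N) : tangentCoord i p (frameVec i p j) = Pi.single j 1 :=
  tangentCoord_ofTangentCoord hp _

theorem tangentCoord_injective {N : ℕ} {i : Fin (N + 1)} {p : CP N}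
    (hp : p ∈ (affChart i).source) : Function.Injective (tangentCoord i p) :=
  (isInvertible_tangentCoord hp).injective

section PullBack

variable {N : ℕ} {Λ : Submodule ℤ ℂ} {φ : ℂ ⧸ Λ → CP N}

/-- The lift of `φ` to `ℂ`, in the `i`-th affine chart. -/
def chartMap (φ : ℂ ⧸ Λ → CP N) (i : Fin (N + 1)) (z : ℂ) : Fin N → ℂ :=
  affChart i (φ (Submodule.Quotient.mk z))

theorem isOpen_frameDomain (hφ : IsHolomorphicMap φ) (i : Fin (N + 1)) :
    IsOpen (frameDomain φ i) :=
  (affChart i).open_source.preimage (MDifferentiable.continuous hφ)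

theorem differentiableAt_chartMap (hφ : IsHolomorphicMap φ) {i : Fin (N + 1)} {z : ℂ}
    (hz : z ∈ frameDomain φ i) : DifferentiableAt ℂ (chartMap φ i) z :=
  (((affChart_mdifferentiable i).mdifferentiableAt hz).comp z (hφ z)).differentiableAt

theorem differentiableOn_chartMap (hφ : IsHolomorphicMap φ) (i : Fin (N + 1)) :
    DifferentiableOn ℂ (chartMap φ i) (frameDomain φ i) := fun _ hz =>
  (differentiableAt_chartMap hφ hz).differentiableWithinAt

theorem contDiffOn_chartMap (hφ : IsHolomorphicMap φ) (i : Fin (N + 1)) :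
    ContDiffOn ℝ ∞ (chartMap φ i) (frameDomain φ i) :=
  ((differentiableOn_chartMap hφ i).contDiffOn (isOpen_frameDomain hφ i)).restrict_scalars ℝ

theorem hasDerivAt_chartMap (hφ : IsHolomorphicMap φ) {i : Fin (N + 1)} {z : ℂ}
    (hz : z ∈ frameDomain φ i) (j : Fin N) :
    HasDerivAt (fun w => chartMap φ i w j) (deriv (chartMap φ i) z j) z :=
  hasDerivAt_pi.1 (differentiableAt_chartMap hφ hz).hasDerivAt j

theorem differentiableAt_deriv_chartMap (hφ : IsHolomorphicMap φ) {i : Fin (N + 1)} {z : ℂ}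
    (hz : z ∈ frameDomain φ i) : DifferentiableAt ℂ (deriv (chartMap φ i)) z :=
  ((differentiableOn_chartMap hφ i).deriv (isOpen_frameDomain hφ i)).differentiableAt
    ((isOpen_frameDomain hφ i).mem_nhds hz)

theorem fubiniStudy_add_left {p : CP N} (ξ₁ ξ₂ η : HolTangent p) :
    fubiniStudy p (ξ₁ + ξ₂) η = fubiniStudy p ξ₁ η + fubiniStudy p ξ₂ η := by
  simp only [fubiniStudy, map_add, fsForm_add_left, mul_add]

theorem fubiniStudy_smul_left {p : CP N} (c : ℂ) (ξ η : HolTangent p) :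
    fubiniStudy p (c • ξ) η = c * fubiniStudy p ξ η := by
  simp only [fubiniStudy, map_smul, fsForm_smul_left]
  ring

theorem conj_fubiniStudy {p : CP N} (ξ η : HolTangent p) :
    conj (fubiniStudy p η ξ) = fubiniStudy p ξ η := by
  rw [fubiniStudy, map_mul, map_inv₀, Complex.conj_ofReal, ← Complex.star_def, star_fsForm]
  rfl

theorem fubiniStudy_self_re_pos {p : CP N} {ξ : HolTangent p} (hξ : ξ ≠ 0) :
    0 < (fubiniStudy p ξ ξ).re := by
  rw [fubiniStudy, ← Complex.ofReal_inv, Complex.re_ofReal_mul]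
  refine mul_pos (inv_pos.2 Real.pi_pos) (fsForm_self_re_pos _ fun h => hξ ?_)
  exact tangentCoord_injective (mem_affIndex p) (h.trans (map_zero _).symm)

theorem fubiniStudy_frameVec {i : Fin (N + 1)} {z : ℂ} (hz : z ∈ frameDomain φ i) (j k : Fin N) :
    fubiniStudy (φ (Submodule.Quotient.mk z)) (frameVec i (φ (Submodule.Quotient.mk z)) j)
      (frameVec i (φ (Submodule.Quotient.mk z)) k) =
    (Real.pi : ℂ)⁻¹ * fsForm (chartMap φ i z) (Pi.single j 1) (Pi.single k 1) := by
  rw [fubiniStudy_eq hz, tangentCoord_frameVec hz, tangentCoord_frameVec hz]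
  rfl

theorem contDiffOn_fsForm_single {s : Set ℂ} {ζ : ℂ → Fin N → ℂ} (hζ : ContDiffOn ℝ ∞ ζ s)
    (x y : Fin N → ℂ) : ContDiffOn ℝ ∞ (fun z => fsForm (ζ z) x y) s := by
  have hj : ∀ j, ContDiffOn ℝ ∞ (fun z => ζ z j) s := contDiffOn_pi.1 hζ
  have hsj : ∀ j, ContDiffOn ℝ ∞ (fun z => star (ζ z j)) s := fun j =>
    (Complex.conjCLE : ℂ →L[ℝ] ℂ).contDiff.comp_contDiffOn (hj j)
  have hρ : ContDiffOn ℝ ∞ (fun z => 1 + ζ z ⬝ᵥ star (ζ z)) s :=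
    contDiffOn_const.add (ContDiffOn.sum fun j _ => (hj j).mul (hsj j))
  have h1 : ContDiffOn ℝ ∞ (fun z => x ⬝ᵥ star (ζ z)) s :=
    ContDiffOn.sum fun j _ => contDiffOn_const.mul (hsj j)
  have h2 : ContDiffOn ℝ ∞ (fun z => ζ z ⬝ᵥ star y) s :=
    ContDiffOn.sum fun j _ => (hj j).mul contDiffOn_const
  simp only [fsForm, div_eq_mul_inv]
  exact ((hρ.mul contDiffOn_const).sub (h1.mul h2)).mul ((hρ.pow 2).inv fun z _ =>
    pow_ne_zero 2 (one_add_dotProduct_star_ne_zero _))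

/-- The Hermitian metric `e^{-f} h`, where `h` is the pull-back of the Fubini-Study metric. -/
def conformalFubiniStudy (hφ : IsHolomorphicMap φ) (f : ℂ ⧸ Λ → ℝ) (hf : IsSmoothFunction f) :
    HermitianMetric φ where
  inner p ξ η := Real.exp (-f p) * fubiniStudy (φ p) ξ η
  add_left p ξ₁ ξ₂ η := by rw [fubiniStudy_add_left, mul_add]
  smul_left p c ξ η := by rw [fubiniStudy_smul_left]; ring
  conj_symm p ξ η := by rw [map_mul, Complex.conj_ofReal, conj_fubiniStudy]
  pos p ξ hξ := by
    rw [Complex.re_ofReal_mul]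
    exact mul_pos (Real.exp_pos _) (fubiniStudy_self_re_pos hξ)
  smooth i j k := by
    have hE : ContDiff ℝ ∞ fun z : ℂ => (Real.exp (-f (Submodule.Quotient.mk z)) : ℂ) :=
      Complex.ofRealCLM.contDiff.comp (hf.neg.exp)
    refine (hE.contDiffOn.mul ((contDiffOn_const (c := (Real.pi : ℂ)⁻¹)).mul (contDiffOn_fsForm_single
      (contDiffOn_chartMap hφ i) (Pi.single j 1) (Pi.single k 1)))).congr fun z hz => ?_
    rw [fubiniStudy_frameVec hz]

variable (h : HermitianMetric φ) {f : ℂ ⧸ Λ → ℝ}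

theorem HermitianMetric.gram_apply
    (hh : ∀ p ξ η, h.inner p ξ η = Real.exp (-f p) * fubiniStudy (φ p) ξ η)
    {i : Fin (N + 1)} {z : ℂ} (hz : z ∈ frameDomain φ i) (j k : Fin N) :
    h.gram i z j k = Complex.exp (-(f (Submodule.Quotient.mk z) : ℂ)) *
      ((Real.pi : ℂ)⁻¹ * fsForm (chartMap φ i z) (Pi.single j 1) (Pi.single k 1)) := by
  rw [HermitianMetric.gram, Matrix.of_apply, hh, fubiniStudy_frameVec hz]
  push_cast
  rfl

/-- A vector in the left kernel would be orthogonal to the whole frame, hence to itself, against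
positivity. -/
theorem HermitianMetric.isUnit_gram
    (hh : ∀ p ξ η, h.inner p ξ η = Real.exp (-f p) * fubiniStudy (φ p) ξ η)
    {i : Fin (N + 1)} {z : ℂ} (hz : z ∈ frameDomain φ i) : IsUnit (h.gram i z) := by
  rw [← Matrix.vecMul_injective_iff_isUnit, ← Matrix.coe_vecMulLinear,
    injective_iff_map_eq_zero]
  intro x hx
  by_contra hx0
  have hk : ∀ k, fsForm (chartMap φ i z) x (Pi.single k 1) = 0 := fun k => by
    have := congrFun hx k
    simp only [Matrix.vecMulLinear_apply, Matrix.vecMul, dotProduct, h.gram_apply hh hz,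
      Pi.zero_apply] at this
    rw [fsForm_eq_sum_left]
    have hc : Complex.exp (-(f (Submodule.Quotient.mk z) : ℂ)) * (Real.pi : ℂ)⁻¹ ≠ 0 :=
      mul_ne_zero (Complex.exp_ne_zero _) (inv_ne_zero (by exact_mod_cast Real.pi_ne_zero))
    refine mul_left_cancel₀ hc ?_
    rw [mul_zero, ← this, Finset.mul_sum]
    exact Finset.sum_congr rfl fun l _ => by ring
  have := fsForm_self_re_pos (chartMap φ i z) hx0
  rw [fsForm_eq_sum_right] at this
  simp [hk] at this

theorem HermitianMetric.connMatrix_eq (hφ : IsHolomorphicMap φ) (hf : IsSmoothFunction f)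
    (hh : ∀ p ξ η, h.inner p ξ η = Real.exp (-f p) * fubiniStudy (φ p) ξ η)
    {i : Fin (N + 1)} {z : ℂ} (hz : z ∈ frameDomain φ i) :
    h.connMatrix i z = fsConn (chartMap φ i z) (deriv (chartMap φ i) z)
      (dZ (fun w => (f (Submodule.Quotient.mk w) : ℂ)) z) := by
  have hF : DifferentiableAt ℝ (fun w : ℂ => (f (Submodule.Quotient.mk w) : ℂ)) z :=
    (Complex.ofRealCLM.contDiff.comp hf).differentiable (by simp) z
  set A := fsConn (chartMap φ i z) (deriv (chartMap φ i) z)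
    (dZ (fun w => (f (Submodule.Quotient.mk w) : ℂ)) z) with hA
  have hd : (Matrix.of fun j k => dZ (fun w => h.gram i w j k) z) = Aᵀ * h.gram i z := by
    ext j k
    obtain ⟨b, hb⟩ := hasWirtingerDerivAt_fsForm_single (hasDerivAt_chartMap hφ hz)
      hF.hasWirtingerDerivAt (Real.pi : ℂ)⁻¹ j k
    have hev : (fun w => h.gram i w j k) =ᶠ[nhds z] fun w =>
        Complex.exp (-(f (Submodule.Quotient.mk w) : ℂ)) *
          ((Real.pi : ℂ)⁻¹ * fsForm (chartMap φ i w) (Pi.single j 1) (Pi.single k 1)) := by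
      filter_upwards [(isOpen_frameDomain hφ i).mem_nhds hz] with w hw
      exact h.gram_apply hh hw j k
    rw [Matrix.of_apply, (hb.congr_of_eventuallyEq hev).dZ_eq, Matrix.mul_apply]
    refine Finset.sum_congr rfl fun l _ => ?_
    rw [h.gram_apply hh hz, Matrix.transpose_apply]
  rw [HermitianMetric.connMatrix, hd, Matrix.mul_nonsing_inv_cancel_right _ _
    ((Matrix.isUnit_iff_isUnit_det _).1 (h.isUnit_gram hh hz)), Matrix.transpose_transpose]

theorem HermitianMetric.tangentCoord_curvature (hφ : IsHolomorphicMap φ) (hf : IsSmoothFunction f)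
    (hh : ∀ p ξ η, h.inner p ξ η = Real.exp (-f p) * fubiniStudy (φ p) ξ η)
    (u : SmoothSection φ) {i : Fin (N + 1)} {z : ℂ} (hz : z ∈ frameDomain φ i) :
    tangentCoord i (φ (Submodule.Quotient.mk z)) (h.curvature i u z) =
      fsForm (chartMap φ i z) (tangentCoord i _ (u.val (Submodule.Quotient.mk z)))
        (deriv (chartMap φ i) z) • deriv (chartMap φ i) z +
      (fsForm (chartMap φ i z) (deriv (chartMap φ i) z) (deriv (chartMap φ i) z) +
        dZbar (dZ fun w => (f (Submodule.Quotient.mk w) : ℂ)) z) •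
          tangentCoord i _ (u.val (Submodule.Quotient.mk z)) := by
  have hF : ContDiff ℝ ∞ (fun w : ℂ => (f (Submodule.Quotient.mk w) : ℂ)) :=
    Complex.ofRealCLM.contDiff.comp hf
  rw [HermitianMetric.curvature, tangentCoord_ofTangentCoord hz]
  rw [← fsConn_commutator (isOpen_frameDomain hφ i) (fun w hw => hasDerivAt_chartMap hφ hw)
    (fun w hw => differentiableAt_pi.1 (differentiableAt_deriv_chartMap hφ hw))
    (hF.contDiffAt.dZ.differentiableAt (by simp)) (u.smooth i) hz]
  -- The formula for the connection matrix holds on the open frame domain, hence near `z`, which is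
  -- all that `∂/∂z̄` at `z` requires.
  have hev : (h.nablaZ i fun w => tangentCoord i (φ (Submodule.Quotient.mk w))
      (u.val (Submodule.Quotient.mk w))) =ᶠ[nhds z] fun w =>
      dZ (fun w => tangentCoord i (φ (Submodule.Quotient.mk w))
        (u.val (Submodule.Quotient.mk w))) w +
      fsConn (chartMap φ i w) (deriv (chartMap φ i) w)
        (dZ (fun w => (f (Submodule.Quotient.mk w) : ℂ)) w) *ᵥ
        tangentCoord i (φ (Submodule.Quotient.mk w)) (u.val (Submodule.Quotient.mk w)) := by
    filter_upwards [(isOpen_frameDomain hφ i).mem_nhds hz] with w hw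
    rw [HermitianMetric.nablaZ, h.connMatrix_eq hφ hf hh hw]
  congr 1
  · rw [HermitianMetric.nablaZ, h.connMatrix_eq hφ hf hh hz]
    rfl
  · rw [HermitianMetric.nablaZbar, dZbar, dZbar, hev.fderiv_eq]

/-- The rank one part of the curvature contributes `⟨u, ζ'⟩⟨ζ', u⟩ = |⟨u, ζ'⟩|²`, so only the scalar
part could be negative. -/
theorem HermitianMetric.inner_curvature (hφ : IsHolomorphicMap φ) (hf : IsSmoothFunction f)
    (hh : ∀ p ξ η, h.inner p ξ η = Real.exp (-f p) * fubiniStudy (φ p) ξ η)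
    (u : SmoothSection φ) {i : Fin (N + 1)} {z : ℂ} (hz : z ∈ frameDomain φ i) {r : ℝ}
    (hr : dZbar (dZ fun w => (f (Submodule.Quotient.mk w) : ℂ)) z = r) :
    h.inner (Submodule.Quotient.mk z) (h.curvature i u z) (u.val (Submodule.Quotient.mk z)) =
      (Real.exp (-f (Submodule.Quotient.mk z)) * (Real.pi⁻¹ *
        (‖fsForm (chartMap φ i z) (tangentCoord i _ (u.val (Submodule.Quotient.mk z)))
          (deriv (chartMap φ i) z)‖ ^ 2)) +
      ((fsForm (chartMap φ i z) (deriv (chartMap φ i) z) (deriv (chartMap φ i) z)).re + r) *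
        (h.inner (Submodule.Quotient.mk z) (u.val (Submodule.Quotient.mk z))
          (u.val (Submodule.Quotient.mk z))).re : ℝ) := by
  rw [hh, hh, fubiniStudy_eq hz, fubiniStudy_eq hz, h.tangentCoord_curvature hφ hf hh u hz, hr,
    show affChart i (φ (Submodule.Quotient.mk z)) = chartMap φ i z from rfl,
    fsForm_add_left, fsForm_smul_left, fsForm_smul_left, ← star_fsForm _ _ (deriv (chartMap φ i) z),
    Complex.star_def, Complex.mul_conj, Complex.normSq_eq_norm_sq]
  have hre : ∀ x, fsForm (chartMap φ i z) x x = ((fsForm (chartMap φ i z) x x).re : ℂ) := fun x =>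
    Complex.ext rfl (by simp [fsForm_self_im])
  rw [Complex.re_ofReal_mul, ← Complex.ofReal_inv, Complex.re_ofReal_mul,
    hre (deriv (chartMap φ i) z), hre (tangentCoord i _ (u.val (Submodule.Quotient.mk z)))]
  simp only [Complex.ofReal_re]
  push_cast
  ring

end PullBack

/-! ### The energy density -/

section Energy

variable {N : ℕ} {Λ : Submodule ℤ ℂ} {φ : ℂ ⧸ Λ → CP N}

/-- The (un-normalised) energy density of `φ`. -/
def energy (φ : ℂ ⧸ Λ → CP N) (z : ℂ) : ℝ :=
  let i := affIndex (φ (Submodule.Quotient.mk z))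
  (fsForm (chartMap φ i z) (deriv (chartMap φ i) z) (deriv (chartMap φ i) z)).re

theorem energy_nonneg (z : ℂ) : 0 ≤ energy φ z := fsForm_self_re_nonneg _ _

theorem deriv_chartMap (hφ : IsHolomorphicMap φ) {i : Fin (N + 1)} {z : ℂ}
    (hz : z ∈ frameDomain φ i) :
    deriv (chartMap φ i) z = tangentCoord i (φ (Submodule.Quotient.mk z))
      (mfderiv 𝓘(ℂ, ℂ) 𝓘(ℂ, Fin N → ℂ) (fun w : ℂ => φ (Submodule.Quotient.mk w)) z (1 : ℂ)) := by
  have hc := mfderiv_comp (I := 𝓘(ℂ, ℂ)) (I' := 𝓘(ℂ, Fin N → ℂ)) (I'' := 𝓘(ℂ, Fin N → ℂ)) z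
    ((affChart_mdifferentiable i).mdifferentiableAt hz) (hφ z)
  rw [← fderiv_apply_one_eq_deriv]
  have h1 : fderiv ℂ (chartMap φ i) z = mfderiv 𝓘(ℂ, ℂ) 𝓘(ℂ, Fin N → ℂ) (chartMap φ i) z :=
    mfderiv_eq_fderiv.symm
  rw [h1, show chartMap φ i = affChart i ∘ fun w : ℂ => φ (Submodule.Quotient.mk w) from rfl, hc]
  rfl

/-- Up to the factor `π`, both sides are the Fubini-Study square norm of `dφ(∂/∂z)`, which is chart
independent. The chart chosen in `energy` may jump with `z`; continuity comes from fixing one chart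
locally. -/
theorem energy_eq (hφ : IsHolomorphicMap φ) {i : Fin (N + 1)} {z : ℂ} (hz : z ∈ frameDomain φ i) :
    energy φ z =
      (fsForm (chartMap φ i z) (deriv (chartMap φ i) z) (deriv (chartMap φ i) z)).re := by
  have hk : z ∈ frameDomain φ (affIndex (φ (Submodule.Quotient.mk z))) := mem_affIndex _
  have h1 := fubiniStudy_eq hz (mfderiv 𝓘(ℂ, ℂ) 𝓘(ℂ, Fin N → ℂ)
    (fun w : ℂ => φ (Submodule.Quotient.mk w)) z (1 : ℂ)) (mfderiv 𝓘(ℂ, ℂ) 𝓘(ℂ, Fin N → ℂ)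
    (fun w : ℂ => φ (Submodule.Quotient.mk w)) z (1 : ℂ))
  rw [fubiniStudy_eq hk, ← deriv_chartMap hφ hz, ← deriv_chartMap hφ hk] at h1
  exact congrArg Complex.re
    (mul_left_cancel₀ (inv_ne_zero (by exact_mod_cast Real.pi_ne_zero)) h1)

theorem continuous_energy (hφ : IsHolomorphicMap φ) : Continuous (energy φ) := by
  refine continuous_iff_continuousAt.2 fun z => ?_
  set i := affIndex (φ (Submodule.Quotient.mk z))
  have hz : z ∈ frameDomain φ i := mem_affIndex _
  have hev : energy φ =ᶠ[nhds z] fun w =>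
      (fsForm (chartMap φ i w) (deriv (chartMap φ i) w) (deriv (chartMap φ i) w)).re := by
    filter_upwards [(isOpen_frameDomain hφ i).mem_nhds hz] with w hw
    exact energy_eq hφ hw
  refine ContinuousAt.congr ?_ hev.symm
  have h1 : ContinuousAt (chartMap φ i) z := (differentiableAt_chartMap hφ hz).continuousAt
  have h2 : ContinuousAt (deriv (chartMap φ i)) z :=
    (differentiableAt_deriv_chartMap hφ hz).continuousAt
  have hdot : ∀ {x y : ℂ → Fin N → ℂ}, ContinuousAt x z → ContinuousAt y z →
      ContinuousAt (fun w => x w ⬝ᵥ star (y w)) z := fun hx hy => by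
    simp only [dotProduct, Pi.star_apply]
    exact tendsto_finsetSum _ fun j _ =>
      ((continuousAt_pi.1 hx j).mul (continuousAt_pi.1 hy j).star)
  have h3 : ContinuousAt (fun w => 1 + chartMap φ i w ⬝ᵥ star (chartMap φ i w)) z :=
    continuousAt_const.add (hdot h1 h1)
  exact Complex.continuous_re.continuousAt.comp
    (((h3.mul (hdot h2 h2)).sub ((hdot h2 h1).mul (hdot h1 h2))).div (h3.pow 2)
      (pow_ne_zero 2 (one_add_dotProduct_star_ne_zero _)))

theorem mk_add_of_mem (z : ℂ) {l : ℂ} (hl : l ∈ Λ) :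
    (Submodule.Quotient.mk (z + l) : ℂ ⧸ Λ) = Submodule.Quotient.mk z := by
  rw [Submodule.Quotient.eq]
  simpa using hl

theorem energy_add_of_mem (z : ℂ) {l : ℂ} (hl : l ∈ Λ) : energy φ (z + l) = energy φ z := by
  have hc : ∀ i w, chartMap φ i (w + l) = chartMap φ i w := fun i w => by
    rw [chartMap, mk_add_of_mem w hl, chartMap]
  have hd : ∀ i w, deriv (chartMap φ i) (w + l) = deriv (chartMap φ i) w := fun i w => by
    rw [← deriv_comp_add_const]
    simp only [hc]
  simp only [energy, mk_add_of_mem z hl, hc, hd]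

/-- Zero energy makes every chart derivative vanish by positivity, so the lift of `φ` is locally
constant on the connected plane. -/
theorem exists_energy_ne_zero (hφ : IsHolomorphicMap φ) (hnc : ¬ ∃ c : CP N, ∀ p, φ p = c) :
    ∃ z, energy φ z ≠ 0 := by
  by_contra! h0
  have hloc : IsLocallyConstant fun z : ℂ => φ (Submodule.Quotient.mk z) := by
    rw [IsLocallyConstant.iff_eventually_eq]
    intro z
    set i := affIndex (φ (Submodule.Quotient.mk z))
    have hz : z ∈ frameDomain φ i := mem_affIndex _
    obtain ⟨r, hr, hball⟩ := Metric.isOpen_iff.1 (isOpen_frameDomain hφ i) z hz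
    have hder : ∀ w ∈ Metric.ball z r, deriv (chartMap φ i) w = 0 := fun w hw => by
      by_contra hne
      exact (fsForm_self_re_pos (chartMap φ i w) hne).ne' ((energy_eq hφ (hball hw)).symm.trans (h0 w))
    filter_upwards [Metric.ball_mem_nhds z hr] with w hw
    refine (affChart i).injOn (hball hw) hz ?_
    exact Metric.isOpen_ball.is_const_of_deriv_eq_zero (convex_ball z r).isPreconnected
      ((differentiableOn_chartMap hφ i).mono hball) hder hw (Metric.mem_ball_self hr)
  refine hnc ⟨φ (Submodule.Quotient.mk 0), fun p => ?_⟩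
  obtain ⟨z, rfl⟩ := Submodule.Quotient.mk_surjective Λ p
  exact hloc.apply_eq_of_preconnectedSpace z 0

end Energy

end

theorem lemma4p3 (N : ℕ) (Λ : Submodule ℤ ℂ) [DiscreteTopology Λ] [IsZLattice ℝ Λ]
    (φ : ℂ ⧸ Λ → CP N) (hφ : IsHolomorphicMap φ) (hnc : ¬ ∃ c : CP N, ∀ p, φ p = c) :
    ∃ (h' : HermitianMetric φ) (f : ℂ ⧸ Λ → ℝ),
      IsSmoothFunction f ∧
      (∀ p ξ η, h'.inner p ξ η = Real.exp (-f p) * fubiniStudy (φ p) ξ η) ∧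
      ∃ a : ℝ, 0 < a ∧ ∀ (u : SmoothSection φ) (i : Fin (N + 1)), ∀ z ∈ frameDomain φ i,
        (h'.inner (Submodule.Quotient.mk z) (h'.curvature i u z)
          (u.val (Submodule.Quotient.mk z))).im = 0 ∧
        a * (h'.inner (Submodule.Quotient.mk z) (u.val (Submodule.Quotient.mk z))
          (u.val (Submodule.Quotient.mk z))).re ≤
            (h'.inner (Submodule.Quotient.mk z) (h'.curvature i u z)
              (u.val (Submodule.Quotient.mk z))).re ∧
        a * (fubiniStudy (φ (Submodule.Quotient.mk z)) (u.val (Submodule.Quotient.mk z))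
          (u.val (Submodule.Quotient.mk z))).re ≤
            (h'.inner (Submodule.Quotient.mk z) (h'.curvature i u z)
              (u.val (Submodule.Quotient.mk z))).re := by
  obtain ⟨F, c, M, hc, hF, hFper, hFM, hFe⟩ := exists_wirtinger_laplacian_ge Λ (energy φ)
    (continuous_energy hφ) (fun z l hl => energy_add_of_mem z hl) energy_nonneg
    (exists_energy_ne_zero hφ hnc)
  obtain ⟨f, hfF⟩ : ∃ f : ℂ ⧸ Λ → ℝ, ∀ z, f (Submodule.Quotient.mk z) = F z := by
    refine ⟨fun p => F (Submodule.Quotient.mk_surjective Λ p).choose, fun z => ?_⟩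
    have h := (Submodule.Quotient.mk_surjective Λ (Submodule.Quotient.mk z)).choose_spec
    have := hFper z _ ((Submodule.Quotient.eq Λ).1 h)
    rwa [add_sub_cancel] at this
  have hf : IsSmoothFunction f := by
    simpa only [IsSmoothFunction, hfF] using hF
  have hh : ∀ p ξ η, (conformalFubiniStudy hφ f hf).inner p ξ η =
      Real.exp (-f p) * fubiniStudy (φ p) ξ η := fun _ _ _ => rfl
  -- The curvature dominates `c h'`. The factor `1` in the minimum serves the bound by `h'`, and
  -- `e^{-M}` the bound by `h`, since `F ≤ M` gives `h' ≥ e^{-M} h`.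
  refine ⟨conformalFubiniStudy hφ f hf, f, hf, hh, c * min 1 (Real.exp (-M)),
    mul_pos hc (lt_min one_pos (Real.exp_pos _)), fun u i z hz => ?_⟩
  obtain ⟨r, hr, hcr⟩ := hFe z
  simp only [← hfF] at hr
  rw [(conformalFubiniStudy hφ f hf).inner_curvature hφ hf hh u hz hr, ← energy_eq hφ hz,
    Complex.ofReal_im, Complex.ofReal_re, hh, Complex.re_ofReal_mul, hfF]
  have hfs : 0 ≤ (fubiniStudy (φ (Submodule.Quotient.mk z)) (u.val (Submodule.Quotient.mk z))
      (u.val (Submodule.Quotient.mk z))).re := by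
    rw [fubiniStudy, ← Complex.ofReal_inv, Complex.re_ofReal_mul]
    exact mul_nonneg (inv_nonneg.2 Real.pi_pos.le) (fsForm_self_re_nonneg _ _)
  have hsq : 0 ≤ Real.exp (-F z) * (Real.pi⁻¹ *
      ‖fsForm (chartMap φ i z) (tangentCoord i _ (u.val (Submodule.Quotient.mk z)))
        (deriv (chartMap φ i) z)‖ ^ 2) := by positivity
  have hmain := mul_le_mul_of_nonneg_right hcr (mul_nonneg (Real.exp_pos (-F z)).le hfs)
  have hexp : Real.exp (-M) ≤ Real.exp (-F z) := Real.exp_le_exp.2 (neg_le_neg (hFM z))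
  refine ⟨rfl, ?_, ?_⟩
  · refine le_trans ?_ (hmain.trans (le_add_of_nonneg_left hsq))
    exact mul_le_mul_of_nonneg_right (mul_le_of_le_one_right hc.le (min_le_left _ _))
      (mul_nonneg (Real.exp_pos _).le hfs)
  · refine le_trans ?_ (hmain.trans (le_add_of_nonneg_left hsq))
    rw [← mul_assoc]
    exact mul_le_mul_of_nonneg_right
      (mul_le_mul_of_nonneg_left ((min_le_right _ _).trans hexp) hc.le) hfs
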